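/- **Theorem 2.1.** Let $A$ be a hermitian, $*$-regular, $*$-semisimple Banach $*$-algebra (complex, not necessarily unital). Then $A$ has spectral synthesis in sense (S) below if and only if $A$ has spectral synthesis in the usual sense (U) below. *Notation.* $Id(A)$ is the set of closed two-sided ideals of $A$, with the topology $\tau_w$ having the sets $\{I\in Id(A): I\not\supseteq J\}$, $J\in Id(A)$, as a subbase. $Prim(A)$ is the set of kernels of algebraically irreducible representations of $A$, $Prim^s(A)$ is the set of proper prime ideals of $A$ that are semisimple (that is, intersections of primitive ideals), and $Prim_*(A)$ is the set of kernels of topologically irreducible $*$-representations of $A$ on Hilbert spaces; these consist of closed ideals, and carry the hull-kernel topology, i.e. the restriction of $\tau_w$. The algebra $A$ is *hermitian* if every self-adjoint element has real spectrum, *$*$-semisimple* if the intersection of the kernels of all topologically irreducible $*$-representations of $A$ on Hilbert spaces is $\{0\}$, and *$*$-regular* if $P\mapsto P\cap A$ (the inverse image of $P$ in $A$) is a homeomorphism of $Prim(C^*(A))$ onto $Prim_*(A)$, where $C^*(A)$ is the C$^*$-envelope of $A$, i.e. the completion of $A$ in the norm $a\mapsto\sup_\pi\|\pi(a)\|$,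 $\pi$ running through the $*$-representations of $A$ on Hilbert spaces. (S) The following three conditions hold: 1. $Prim^s(A)$ is locally compact (each point has a neighbourhood base of compact sets); 2. $\tau_w$ has the normality property on $Prim(A)$: if a net $(P_\alpha)$ in $Prim(A)$ converges to $P\in Prim(A)$, then $\liminf_\alpha\|a+P_\alpha\|>0$ for every $a\in A\setminus P$, where $\|a+P_\alpha\|$ is the quotient norm in $A/P_\alpha$; 3. $I\mapsto\{P\in Prim(A): P\not\supseteq I\}$ is an isomorphism of $Id(A)$ onto the lattice of open subsets of $Prim(A)$. (U) For each closed subset $S$ of $Prim_*(A)$ there is a unique $I\in Id(A)$ whose hull $\{P\in Prim_*(A): P\supseteq I\}$ is $S$. -/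

import Mathlib

open Filter Topology
open scoped ENNReal

universe u

noncomputable section

/-! ### Closed two-sided ideals and the topology `τ_w` -/

/-- The set `Id(A)` of closed two-sided ideals of a (possibly non-unital) complex Banach algebra;
ideals are complex linear subspaces. -/
structure ClosedIdeal (A : Type u) [NonUnitalNormedRing A] [NormedSpace ℂ A]
    extends Submodule ℂ A where
  mul_mem_left' : ∀ (a : A) {x : A}, x ∈ carrier → a * x ∈ carrier
  mul_mem_right' : ∀ {x : A} (a : A), x ∈ carrier → x * a ∈ carrier
  isClosed' : IsClosed carrier

namespace ClosedIdeal

variable {A : Type u} [NonUnitalNormedRing A] [NormedSpace ℂ A]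

theorem toSubmodule_injective :
    Function.Injective (toSubmodule : ClosedIdeal A → Submodule ℂ A) := by
  rintro ⟨I, _, _, _⟩ ⟨J, _, _, _⟩ h
  cases h
  rfl

instance : SetLike (ClosedIdeal A) A where
  coe I := I.carrier
  coe_injective _ _ h := toSubmodule_injective (SetLike.coe_injective h)

/-- Closed ideals are ordered by inclusion. -/
instance : PartialOrder (ClosedIdeal A) := PartialOrder.ofSetLike (ClosedIdeal A) A

/-- The topology `τ_w` on `Id(A)`: the sets `{I | I ⊉ J}`, for `J ∈ Id(A)`, form a subbase.
On sets of prime ideals it restricts to the hull-kernel topology. -/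
instance : TopologicalSpace (ClosedIdeal A) :=
  TopologicalSpace.generateFrom (Set.range fun J : ClosedIdeal A => {I | ¬ J ≤ I})

/-- The norm `‖a + I‖` of the image of `a` in the quotient `A / I`. -/
def quotNorm (a : A) (I : ClosedIdeal A) : ℝ :=
  ‖(Submodule.Quotient.mk a : A ⧸ I.toSubmodule)‖

/-- A net `(I_α)` in `Id(A)` has the normality property with respect to `I` if
`liminf ‖a + I_α‖ > 0` for every `a ∉ I`. -/
def NetNormality {ι : Type u} [Preorder ι] (net : ι → ClosedIdeal A) (I : ClosedIdeal A) : Prop :=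
  ∀ a : A, a ∉ I → 0 < liminf (fun α => quotNorm a (net α)) atTop

/-- `I` is a proper prime ideal. -/
def IsPrime (I : ClosedIdeal A) : Prop :=
  (∃ a : A, a ∉ I) ∧
    ∀ J K : ClosedIdeal A, (∀ a ∈ J, ∀ b ∈ K, a * b ∈ I) → J ≤ I ∨ K ≤ I

end ClosedIdeal

/-! ### Primitive ideals and the paper's spectral synthesis -/

section Primitive

variable (A : Type u) [NonUnitalNormedRing A] [NormedSpace ℂ A]

variable {A} in
/-- An algebraically irreducible representation of `A` on a complex vector space: it is not zero and
has no invariant subspaces other than `0` and the whole space. -/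
def IsAlgIrreducible {X : Type u} [AddCommGroup X] [Module ℂ X]
    (π : A →ₙₐ[ℂ] Module.End ℂ X) : Prop :=
  π ≠ 0 ∧ ∀ K : Submodule ℂ X, (∀ a : A, ∀ x ∈ K, π a x ∈ K) → K = ⊥ ∨ K = ⊤

/-- `Prim(A)`: the kernels of the algebraically irreducible representations of `A` (in a Banach
algebra these are closed). As a subset of `Id(A)` it carries the hull-kernel topology. The underlying
space of an irreducible representation is a quotient of `A`, so one universe suffices. -/
def Prim : Set (ClosedIdeal A) :=
  {P | ∃ (X : Type u) (_ : AddCommGroup X) (_ : Module ℂ X) (π : A →ₙₐ[ℂ] Module.End ℂ X),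
    IsAlgIrreducible π ∧ ∀ a : A, a ∈ P ↔ π a = 0}

variable {A} in
/-- A closed ideal is semisimple if it is the intersection of the primitive ideals containing it. -/
def ClosedIdeal.IsSemisimple (I : ClosedIdeal A) : Prop :=
  ∀ a : A, (∀ P ∈ Prim A, I ≤ P → a ∈ P) → a ∈ I

/-- `Prim^s(A)`: the semisimple (proper) prime ideals. -/
def PrimS : Set (ClosedIdeal A) :=
  {P | P.IsPrime ∧ P.IsSemisimple}

/-- `τ_w` has the normality property on `Prim(A)`: nets in `Prim(A)` have the normality property
with respect to each of their limits in `Prim(A)`. -/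
def NormalityOnPrim : Prop :=
  ∀ (ι : Type u) [Preorder ι] [IsDirectedOrder ι] [Nonempty ι] (net : ι → Prim A) (P : Prim A),
    Tendsto net atTop (𝓝 P) →
      ClosedIdeal.NetNormality (fun α => (net α : ClosedIdeal A)) (P : ClosedIdeal A)

/-- Spectral synthesis for a Banach algebra, in the sense of the paper. -/
structure HasSpectralSynthesis : Prop where
  /-- Every point of `Prim^s(A)` has a neighbourhood base of compact sets. -/
  locallyCompact : LocallyCompactSpace (PrimS A)
  normality : NormalityOnPrim A
  /-- `I ↦ {P ∈ Prim(A) | P ⊉ I}` is an isomorphism of `Id(A)` onto the lattice of open subsets of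
  `Prim(A)`. -/
  latticeIso : ∃ e : ClosedIdeal A ≃o TopologicalSpace.Opens (Prim A),
    ∀ (I : ClosedIdeal A) (P : Prim A), P ∈ e I ↔ ¬ I ≤ (P : ClosedIdeal A)

end Primitive

/-! ### `*`-representations, `Prim_*(A)` and the `C*`-envelope -/

/-- A `*`-representation of `A` by bounded operators on a complex Hilbert space `H`. -/
structure StarRep (A : Type u) [NonUnitalNormedRing A] [NormedSpace ℂ A] [StarRing A] where
  H : Type u
  [normedAddCommGroup : NormedAddCommGroup H]
  [innerProductSpace : InnerProductSpace ℂ H]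
  [completeSpace : CompleteSpace H]
  π : A →⋆ₙₐ[ℂ] (H →L[ℂ] H)

attribute [instance] StarRep.normedAddCommGroup StarRep.innerProductSpace StarRep.completeSpace

section Star

variable (A : Type u) [NonUnitalNormedRing A] [NormedSpace ℂ A] [StarRing A]

variable {A} in
/-- Topological irreducibility: the representation is not zero and has no closed invariant subspaces
other than `0` and the whole space. -/
def StarRep.IsTopIrreducible (ρ : StarRep A) : Prop :=
  ρ.π ≠ 0 ∧ ∀ K : Submodule ℂ ρ.H, IsClosed (K : Set ρ.H) →
    (∀ a : A, ∀ x ∈ K, ρ.π a x ∈ K) → K = ⊥ ∨ K = ⊤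

/-- `Prim_*(A)`: the kernels of the topologically irreducible `*`-representations of `A` on Hilbert
spaces (these are closed), with the hull-kernel topology. The Hilbert space is the completion of a
quotient of `A`, so one universe suffices. -/
def PrimStar : Set (ClosedIdeal A) :=
  {P | ∃ ρ : StarRep A, ρ.IsTopIrreducible ∧ ∀ a : A, a ∈ P ↔ ρ.π a = 0}

/-- `A` is `*`-semisimple: its topologically irreducible `*`-representations separate points. -/
def IsStarSemisimple : Prop :=
  ∀ a : A, (∀ ρ : StarRep A, ρ.IsTopIrreducible → ρ.π a = 0) → a = 0

/-- `A` is hermitian: self-adjoint elements have real spectrum. The quasispectrum is the spectrum in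
the unitization; for a unital algebra it is the spectrum with `0` adjoined. -/
def IsHermitianAlgebra [IsScalarTower ℂ A A] [SMulCommClass ℂ A A] : Prop :=
  ∀ a : A, IsSelfAdjoint a → ∀ z ∈ quasispectrum ℂ a, z.im = 0

/-- Spectral synthesis in the usual sense for `*`-semisimple Banach `*`-algebras: each closed subset
of `Prim_*(A)` is the hull of a unique closed ideal of `A`. -/
def HasUsualSpectralSynthesis : Prop :=
  ∀ S : Set (PrimStar A), IsClosed S →
    ∃! I : ClosedIdeal A, {P : PrimStar A | I ≤ (P : ClosedIdeal A)} = S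

end Star

section Envelope

variable {A : Type u} [NonUnitalNormedRing A] [NormedSpace ℂ A] [CompleteSpace A]
  [IsScalarTower ℂ A A] [SMulCommClass ℂ A A] [StarRing A]

/-- A `*`-representation of a Banach `*`-algebra is norm-decreasing on self-adjoint elements. -/
theorem StarRep.norm_le_of_isSelfAdjoint (ρ : StarRep A) {h : A} (hh : IsSelfAdjoint h) :
    ‖ρ.π h‖ ≤ ‖h‖ := by
  let Φ : WithLp 1 (Unitization ℂ A) →ₐ[ℂ] (ρ.H →L[ℂ] ρ.H) :=
    (Unitization.lift (ρ.π : A →ₙₐ[ℂ] (ρ.H →L[ℂ] ρ.H))).comp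
      (WithLp.unitizationAlgEquiv ℂ (𝕜 := ℂ) (A := A)).toAlgHom
  let x : WithLp 1 (Unitization ℂ A) := WithLp.toLp 1 (h : Unitization ℂ A)
  have hΦ : Φ x = ρ.π h := by
    simp [Φ, x]
    rfl
  have hx : ‖x‖ = ‖h‖ := WithLp.unitization_norm_inr h
  have hsa : IsSelfAdjoint (ρ.π h) := hh.map ρ.π
  have h1 : spectralRadius ℂ (ρ.π h) ≤ spectralRadius ℂ x := by
    rw [← hΦ]
    exact biSup_mono fun z hz => AlgHom.spectrum_apply_subset Φ x hz
  have : NormOneClass (WithLp 1 (Unitization ℂ A)) :=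
    ⟨by
      rw [WithLp.unitization_norm_def]
      change ‖(1 : ℂ)‖ + ‖(0 : A)‖ = 1
      simp⟩
  have h2 : (‖ρ.π h‖₊ : ℝ≥0∞) ≤ ‖x‖₊ := by
    rw [← hsa.spectralRadius_eq_nnnorm]
    exact h1.trans (spectrum.spectralRadius_le_nnnorm x)
  rw [← hx]
  exact_mod_cast h2

theorem StarRep.norm_le (ρ : StarRep A) (a : A) : ‖ρ.π a‖ ≤ √‖star a * a‖ := by
  apply Real.le_sqrt_of_sq_le
  calc ‖ρ.π a‖ ^ 2 = ‖ρ.π (star a * a)‖ := by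
        rw [map_mul, map_star, CStarRing.norm_star_mul_self, sq]
    _ ≤ _ := ρ.norm_le_of_isSelfAdjoint (IsSelfAdjoint.star_mul_self a)

variable (A) in
/-- The `C*`-algebra of bounded families `(T_ρ)`, with `T_ρ` a bounded operator on the space of `ρ`,
where `ρ` runs through the `*`-representations of `A`; the norm is `sup_ρ ‖T_ρ‖`. -/
abbrev UniversalTarget : Type (u + 1) :=
  lp (fun ρ : StarRep A => ρ.H →L[ℂ] ρ.H) ∞

variable (A) in
/-- The universal representation `a ↦ (ρ(a))_ρ`, so that `‖universalRep A a‖ = sup_ρ ‖ρ(a)‖`. -/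
def universalRep : A →⋆ₙₐ[ℂ] UniversalTarget A where
  toFun a := ⟨fun ρ => ρ.π a,
    memℓp_infty ⟨√‖star a * a‖, by rintro _ ⟨ρ, rfl⟩; exact ρ.norm_le a⟩⟩
  map_smul' c a := by ext1; funext ρ; exact map_smul ρ.π c a
  map_zero' := by ext1; funext ρ; exact map_zero ρ.π
  map_add' a b := by ext1; funext ρ; exact map_add ρ.π a b
  map_mul' a b := by ext1; funext ρ; exact map_mul ρ.π a b
  map_star' a := by ext1; funext ρ; exact map_star ρ.π a

variable (A) in
/-- The `C*`-envelope `C*(A)`: the completion of `A` in the norm `a ↦ sup_ρ ‖ρ(a)‖`, realized as the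
closure of the image of `A` under its universal representation. -/
def CStarEnvelope : NonUnitalStarSubalgebra ℂ (UniversalTarget A) :=
  (NonUnitalStarAlgHom.range (universalRep A)).topologicalClosure

variable (A) in
/-- `C*(A)` is a (non-unital) `C*`-algebra. -/
instance CStarEnvelope.instNonUnitalCStarAlgebra : NonUnitalCStarAlgebra (CStarEnvelope A) :=
  have : IsClosed (CStarEnvelope A : Set (UniversalTarget A)) :=
    NonUnitalStarSubalgebra.isClosed_topologicalClosure _
  NonUnitalStarSubalgebra.nonUnitalCStarAlgebra (CStarEnvelope A)

/-- The canonical map `A → C*(A)`. -/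
def toCStarEnvelope (a : A) : CStarEnvelope A :=
  ⟨universalRep A a, NonUnitalStarSubalgebra.le_topologicalClosure _ ⟨a, rfl⟩⟩

variable (A) in
/-- `A` is `*`-regular: `P ↦ P ∩ A` is a homeomorphism of `Prim(C*(A))` onto `Prim_*(A)`. -/
def IsStarRegular : Prop :=
  ∃ e : Prim (CStarEnvelope A) ≃ₜ PrimStar A,
    ∀ (P : Prim (CStarEnvelope A)) (a : A),
      a ∈ (e P : ClosedIdeal A) ↔ toCStarEnvelope a ∈ (P : ClosedIdeal (CStarEnvelope A))

end Envelope

end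

noncomputable section

/-! ### Spectral radius estimates in unital Banach algebras -/

section SpectralRadius

variable {B : Type*} [NormedRing B] [NormedAlgebra ℂ B] [CompleteSpace B]

/-! Everything rests on the chain `Prim A ⊆ PrimStar A ⊆ PrimS A`.

The first inclusion uses hermitian. `*`-semisimplicity makes the involution continuous
(`continuousStar_of_isStarSemisimple`). In the unitization, Ford's square roots and Pták's
inequality give the Shirali–Ford theorem: every `x⋆ x` has nonnegative spectrum, and such elements
form a cone. A Hahn–Banach separation then yields states vanishing on a given proper left ideal `L`.
For `L` maximal, an extreme such state has left kernel exactly `L`, so its GNS representation is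
irreducible with the same kernel as the module `B / L` (`UnitalHermitian.exists_starRep`,
`prim_subset_primStar`).

The second inclusion is general: an element outside the kernel of a `*`-representation produces a
self-adjoint element with no left quasi-inverse modulo that kernel, and Zorn's lemma then provides a
primitive ideal above the kernel that still excludes the element (`exists_prim_of_forall_notMem`).

(S) implies (U): a closed set of prime ideals is the hull of its kernel. Two ideals with equal hulls
in `PrimStar A` have equal hulls in `Prim A`, hence coincide by the lattice isomorphism.

(U) implies (S): uniqueness makes every closed ideal the kernel of its hull, hence semisimple, and
this is the lattice isomorphism. The topological conditions follow from `*`-regularity alone,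
granted the chain and the continuous involution. They hold for `Prim` of a C*-algebra, by functional
calculus and compactness of the sets of primitive ideals modulo which a given element has no left
quasi-inverse, and they transfer along the homeomorphism with `PrimStar A`. -/

theorem eventually_norm_pow_lt_of_spectralRadius_lt {a : B} {M : ℝ}
    (h : spectralRadius ℂ a < ENNReal.ofReal M) : ∀ᶠ n : ℕ in atTop, ‖a ^ n‖ < M ^ n := by
  have hM : 0 < M := ENNReal.ofReal_pos.mp (bot_le.trans_lt h)
  filter_upwards [(spectrum.pow_norm_pow_one_div_tendsto_nhds_spectralRadius a).eventually_lt_const h,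
    eventually_ge_atTop 1] with n hn h1
  rw [ENNReal.ofReal_lt_ofReal_iff hM] at hn
  have hn0 : (n : ℝ) ≠ 0 := by positivity
  calc ‖a ^ n‖ = (‖a ^ n‖ ^ (1 / n : ℝ)) ^ n := by
        rw [← Real.rpow_natCast, ← Real.rpow_mul (norm_nonneg _), one_div_mul_cancel hn0,
          Real.rpow_one]
    _ < M ^ n := by gcongr

theorem summable_norm_pow_of_spectralRadius_lt_one {a : B} (h : spectralRadius ℂ a < 1) :
    Summable fun n : ℕ => ‖a ^ n‖ := by
  obtain ⟨ρ, h1, h2⟩ := ENNReal.lt_iff_exists_nnreal_btwn.mp h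
  have h1' : spectralRadius ℂ a < ENNReal.ofReal (ρ : ℝ) := by simpa using h1
  refine Summable.of_norm_bounded_eventually_nat
    (summable_geometric_of_lt_one ρ.2 (by exact_mod_cast h2)) ?_
  filter_upwards [eventually_norm_pow_lt_of_spectralRadius_lt h1'] with n hn
  rw [norm_norm]
  exact hn.le

/-- One exponent suffices: submultiplicativity spreads the bound to all multiples of `n`, a
subsequence of Gelfand's formula. -/
theorem spectralRadius_pow_le_of_norm_pow_le {a : B} {n : ℕ} (hn : n ≠ 0) {M : ℝ} (hM : 0 ≤ M)
    (h : ‖a ^ n‖ ≤ M ^ n) : spectralRadius ℂ a ≤ ENNReal.ofReal M := by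
  have key : ∀ k : ℕ, ‖a ^ (n * (k + 1))‖ ≤ M ^ (n * (k + 1)) := fun k => by
    rw [pow_mul, pow_mul]
    exact (norm_pow_le' _ k.succ_pos).trans (by gcongr)
  by_contra! hlt
  obtain ⟨ρ, h1, h2⟩ := ENNReal.lt_iff_exists_nnreal_btwn.mp hlt
  have hev := (spectrum.pow_norm_pow_one_div_tendsto_nhds_spectralRadius a).eventually_const_lt h2
  have hsub : Tendsto (fun k : ℕ => n * (k + 1)) atTop atTop :=
    tendsto_atTop_mono (fun k => (Nat.le_succ k).trans (Nat.le_mul_of_pos_left _ (Nat.pos_of_ne_zero hn))) tendsto_id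
  obtain ⟨k, hk⟩ := (hsub.eventually hev).exists
  have hpos : ((n * (k + 1) : ℕ) : ℝ) ≠ 0 := by positivity
  have : ‖a ^ (n * (k + 1))‖ ^ (1 / ((n * (k + 1) : ℕ) : ℝ)) ≤ M := by
    calc _ ≤ (M ^ (n * (k + 1))) ^ (1 / ((n * (k + 1) : ℕ) : ℝ)) := by
          gcongr; exact key k
      _ = M := by
          rw [← Real.rpow_natCast, ← Real.rpow_mul hM, mul_one_div_cancel hpos, Real.rpow_one]
  exact absurd (h1.trans hk) (not_lt.mpr (ENNReal.ofReal_le_ofReal this))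

/-- Three circles: a bound for `r(p + q)` from bounds for `z • p + q` on two circles. -/
theorem spectralRadius_add_sq_le {p q : B} {R M : ℝ} (hR : 1 < R) (hM : 0 ≤ M)
    (h : ∀ z : ℂ, ‖z‖ = R → spectralRadius ℂ (z • p + q) < ENNReal.ofReal M) :
    spectralRadius ℂ (p + q) ^ 2 ≤ ENNReal.ofReal (M * (‖p‖ / R + ‖q‖)) := by
  have hR0 : 0 < R := one_pos.trans hR
  -- Gelfand's formula gives an exponent at each point of the circle; by continuity it works nearby.
  have hloc : ∀ z ∈ Metric.sphere (0 : ℂ) R, ∃ n : ℕ, n ≠ 0 ∧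
      ∀ᶠ w in 𝓝 z, ‖(w • p + q) ^ n‖ < M ^ n := fun z hz => by
    obtain ⟨n, hn, hn0⟩ := ((eventually_norm_pow_lt_of_spectralRadius_lt
      (h z (by simpa using hz))).and (eventually_ne_atTop 0)).exists
    refine ⟨n, hn0, ContinuousAt.eventually_lt (by fun_prop) (by fun_prop) hn⟩
  choose! n hn0 hn using hloc
  obtain ⟨t, ht⟩ := (isCompact_sphere (0 : ℂ) R).elim_nhds_subcover'
    (fun z _ => {w | ‖(w • p + q) ^ n z‖ < M ^ n z}) (fun z hz => hn z hz)
  -- A common multiple of the finitely many exponents serves the whole circle.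
  set N : ℕ := ∏ z ∈ t, n z with hN
  have hN0 : N ≠ 0 := Finset.prod_ne_zero_iff.mpr fun z _ => hn0 z z.2
  have hcirc : ∀ w : ℂ, ‖w‖ = R → ‖(w • p + q) ^ N‖ ≤ M ^ N := fun w hw => by
    have := ht (show w ∈ Metric.sphere (0 : ℂ) R by simpa using hw)
    simp only [Set.mem_iUnion] at this
    obtain ⟨z, hz, hwz⟩ := this
    obtain ⟨k, hk⟩ : n z ∣ N := Finset.dvd_prod_of_mem (fun z : Metric.sphere (0 : ℂ) R => n z) hz
    have hk0 : k ≠ 0 := by rintro rfl; exact hN0 (by simpa using hk)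
    rw [hk, pow_mul, pow_mul]
    refine (norm_pow_le' _ (Nat.pos_of_ne_zero hk0)).trans ?_
    gcongr
    exact hwz.le
  set L : ℝ := Real.log R with hL
  have hL0 : 0 < L := Real.log_pos hR
  set m : ℝ := ‖p‖ / R + ‖q‖ with hm
  have hm0 : 0 ≤ m := by positivity
  -- The substitution `z = exp s` turns the annulus `1/R ≤ |z| ≤ R` into a strip symmetric about
  -- `0`. At its midpoint the two boundary bounds, `m ^ N` on the left (triangle inequality) and `M
  -- ^ N` on the right, enter with exponent `1/2` each.
  let f : ℂ → B := fun s => (Complex.exp s • p + q) ^ N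
  have hf : Differentiable ℂ f := by
    have : Differentiable ℂ fun s : ℂ => Complex.exp s • p + q := by fun_prop
    exact this.pow N
  have hexp : ∀ s : ℂ, ‖Complex.exp s • p + q‖ ≤ Real.exp s.re * ‖p‖ + ‖q‖ := fun s => by
    refine (norm_add_le _ _).trans ?_
    rw [norm_smul, Complex.norm_exp]
  have key : ‖f 0‖ ≤ (m ^ N) ^ (1 - ((0 : ℂ).re - -L) / (L - -L)) *
      (M ^ N) ^ (((0 : ℂ).re - -L) / (L - -L)) := by
    refine Complex.HadamardThreeLines.norm_le_interp_of_mem_verticalClosedStrip' (by linarith)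
      ?_ hf.diffContOnCl ?_ ?_ ?_
    · simp [Complex.HadamardThreeLines.verticalClosedStrip, hL0.le]
    · refine ⟨(R * ‖p‖ + ‖q‖) ^ N, ?_⟩
      rintro _ ⟨s, hs, rfl⟩
      refine (norm_pow_le' _ (Nat.pos_of_ne_zero hN0)).trans ?_
      gcongr
      refine (hexp s).trans ?_
      gcongr
      calc Real.exp s.re ≤ Real.exp L := Real.exp_le_exp.mpr hs.2
        _ = R := Real.exp_log hR0
    · intro s hs
      refine (norm_pow_le' _ (Nat.pos_of_ne_zero hN0)).trans ?_
      gcongr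
      refine (hexp s).trans_eq ?_
      have hs' : s.re = -L := hs
      rw [hs', Real.exp_neg, hL, Real.exp_log hR0, hm, div_eq_inv_mul]
    · intro s hs
      have hs' : s.re = L := hs
      exact hcirc _ (by rw [Complex.norm_exp, hs', hL, Real.exp_log hR0])
  have hhalf : ((0 : ℂ).re - -L) / (L - -L) = 1 / 2 := by
    simp only [Complex.zero_re]; field_simp; ring
  rw [hhalf, show (1 : ℝ) - 1 / 2 = 1 / 2 by norm_num, ← Real.mul_rpow (by positivity)
    (by positivity), ← Real.sqrt_eq_rpow, ← mul_pow] at key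
  have key2 : ‖(p + q) ^ N‖ ≤ (√(M * m)) ^ N := by
    have : f 0 = (p + q) ^ N := by simp [f]
    rw [← this]
    refine key.trans_eq ?_
    rw [mul_comm M m]
    rw [Real.sqrt_eq_iff_mul_self_eq (by positivity) (by positivity), ← mul_pow,
      Real.mul_self_sqrt (by positivity)]
  calc spectralRadius ℂ (p + q) ^ 2 ≤ (ENNReal.ofReal √(M * m)) ^ 2 := by
        gcongr
        exact spectralRadius_pow_le_of_norm_pow_le hN0 (Real.sqrt_nonneg _) key2
    _ = ENNReal.ofReal (M * m) := by
        rw [← ENNReal.ofReal_pow (Real.sqrt_nonneg _), Real.sq_sqrt (by positivity)]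

/-- The value at `h / 4` of the generating function of the Catalan numbers. -/
def catalanSum (h : B) : B := ∑' n, ((catalan n : ℝ) / 4 ^ n) • h ^ n

omit [CompleteSpace B] in
theorem commute_catalanSum (h : B) : Commute h (catalanSum h) :=
  Commute.tsum_right _ fun n => ((Commute.refl h).pow_right n).smul_right _

/-- This is the functional equation `C = 1 + x C²` at `x = h / 4`. Since `catalan n ≤ 4 ^ n`, the
series is dominated by `∑ ‖h ^ n‖`, so the Cauchy product and the Catalan recursion apply. -/
theorem catalanSum_eq {h : B} (hh : spectralRadius ℂ h < 1) :
    catalanSum h = 1 + (4⁻¹ : ℝ) • (h * (catalanSum h * catalanSum h)) := by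
  let d : ℕ → ℝ := fun n => (catalan n : ℝ) / 4 ^ n
  have hd0 : ∀ n, 0 ≤ d n := fun n => by positivity
  have hd1 : ∀ n, d n ≤ 1 := fun n => by
    rw [div_le_one (by positivity)]
    have : catalan n ≤ 4 ^ n := by
      rw [catalan_eq_centralBinom_div, Nat.centralBinom_eq_two_mul_choose]
      refine (Nat.div_le_self _ _).trans ((Nat.choose_le_two_pow _ _).trans_eq ?_)
      rw [pow_mul]; norm_num
    exact_mod_cast this
  have hS : Summable fun n => ‖d n • h ^ n‖ := by
    refine Summable.of_nonneg_of_le (fun _ => norm_nonneg _) (fun n => ?_)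
      (summable_norm_pow_of_spectralRadius_lt_one hh)
    rw [norm_smul, Real.norm_of_nonneg (hd0 n)]
    exact mul_le_of_le_one_left (norm_nonneg _) (hd1 n)
  change ∑' n, d n • h ^ n =
    1 + (4⁻¹ : ℝ) • (h * ((∑' n, d n • h ^ n) * (∑' n, d n • h ^ n)))
  have hprod := (summable_norm_sum_mul_antidiagonal_of_summable_norm hS hS).of_norm
  rw [tsum_mul_tsum_eq_tsum_sum_antidiagonal_of_summable_norm hS hS, ← hprod.tsum_mul_left,
    ← (hprod.mul_left h).tsum_const_smul, hS.of_norm.tsum_eq_zero_add]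
  congr 1
  · simp [d]
  · refine tsum_congr fun n => ?_
    simp only [d, catalan_succ', Nat.cast_sum, Nat.cast_mul, Finset.sum_div, Finset.sum_smul,
      Finset.mul_sum, Finset.smul_sum]
    refine Finset.sum_congr rfl fun kl hkl => ?_
    rw [Finset.HasAntidiagonal.mem_antidiagonal] at hkl
    rw [smul_mul_smul_comm, ← pow_add, hkl, mul_smul_comm, ← pow_succ', smul_smul, ← hkl]
    congr 1
    rw [pow_succ, pow_add]
    field_simp

/-- Solving the quadratic functional equation formally gives `√(1 - h) = 1 - h C / 2`. -/
theorem sq_one_sub_catalanSum {h : B} (hh : spectralRadius ℂ h < 1) :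
    (1 - (2⁻¹ : ℝ) • (h * catalanSum h)) * (1 - (2⁻¹ : ℝ) • (h * catalanSum h)) = 1 - h := by
  have h1 := catalanSum_eq hh
  have hc := commute_catalanSum h
  set S := catalanSum h
  have h2 : (h * S) * (h * S) = (4 : ℝ) • (h * S) - (4 : ℝ) • h := by
    have : h * S = h + (4⁻¹ : ℝ) • ((h * S) * (h * S)) := by
      conv_lhs => rw [h1]
      rw [mul_add, mul_one, mul_smul_comm]
      congr 2
      rw [mul_assoc h S, ← mul_assoc S h, ← hc.eq]
      simp only [mul_assoc]
    nth_rw 3 [this]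
    module
  rw [mul_sub, sub_mul, sub_mul, one_mul, mul_one, one_mul, smul_mul_smul_comm, h2]
  module

end SpectralRadius

/-! ### Spectral radius and square roots in the presence of an involution. -/

section Star

variable {B : Type*} [NormedRing B] [NormedAlgebra ℂ B] [StarRing B] [StarModule ℂ B]

theorem spectralRadius_star (a : B) : spectralRadius ℂ (star a) = spectralRadius ℂ a := by
  have : ∀ a : B, spectralRadius ℂ (star a) ≤ spectralRadius ℂ a := fun a =>
    iSup₂_le fun z hz => by
      rw [spectrum.map_star] at hz
      have h := le_iSup₂ (f := fun (k : ℂ) (_ : k ∈ spectrum ℂ a) => (‖k‖₊ : ℝ≥0∞)) (star z) hz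
      simpa [spectralRadius] using h
  refine (this a).antisymm ?_
  simpa using this (star a)

theorem isSelfAdjoint_catalanSum [ContinuousStar B] {h : B} (hh : IsSelfAdjoint h) :
    IsSelfAdjoint (catalanSum h) := by
  rw [IsSelfAdjoint, catalanSum, tsum_star]
  refine tsum_congr fun n => ?_
  have h1 : star (((catalan n : ℝ) / 4 ^ n) • h ^ n) = ((catalan n : ℝ) / 4 ^ n) • star (h ^ n) := by
    rw [← Complex.coe_smul, ← Complex.coe_smul, star_smul]
    simp
  rw [h1, star_pow, hh.star_eq]

/-- Ford's square root lemma. -/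
theorem exists_isSelfAdjoint_mul_self_eq [CompleteSpace B] [ContinuousStar B] {h : B}
    (hh : IsSelfAdjoint h) (hr : spectralRadius ℂ h < 1) :
    ∃ u : B, IsSelfAdjoint u ∧ u * u = 1 - h := by
  refine ⟨1 - (2⁻¹ : ℝ) • (h * catalanSum h), ?_, sq_one_sub_catalanSum hr⟩
  have h1 : IsSelfAdjoint (h * catalanSum h) := 
    (hh.commute_iff (isSelfAdjoint_catalanSum hh)).mp (commute_catalanSum h)
  rw [← Complex.coe_smul]
  exact (IsSelfAdjoint.one B).sub (IsSelfAdjoint.smul (by simp [IsSelfAdjoint]) h1)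

end Star

/-! ### The unitization of a Banach `*`-algebra -/

section UnitizationStar

variable {A : Type*} [NonUnitalNormedRing A] [NormedSpace ℂ A] [IsScalarTower ℂ A A]
  [SMulCommClass ℂ A A] [StarRing A] [StarModule ℂ A]

/-- The unitization of `A` with the `ℓ¹`-norm. -/
abbrev L1Unitization (A : Type*) [NonUnitalNormedRing A] [NormedSpace ℂ A] [IsScalarTower ℂ A A]
    [SMulCommClass ℂ A A] : Type _ := WithLp 1 (Unitization ℂ A)

/-- The embedding of `A` into its unitization. -/
def toL1 (a : A) : L1Unitization A := WithLp.toLp 1 (a : Unitization ℂ A)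

instance : StarRing (L1Unitization A) where
  star x := WithLp.toLp 1 (star (WithLp.ofLp x))
  star_involutive x := by simp
  star_mul x y := by
    apply WithLp.ofLp_injective 1
    exact star_mul (WithLp.ofLp x) (WithLp.ofLp y)
  star_add x y := by
    apply WithLp.ofLp_injective 1
    simp

instance : StarModule ℂ (L1Unitization A) where
  star_smul r x := by
    apply WithLp.ofLp_injective 1
    change star (r • WithLp.ofLp x) = star r • star (WithLp.ofLp x)
    simp

omit [StarRing A] [StarModule ℂ A] in
theorem continuous_l1Unitization_fst :
    Continuous fun x : L1Unitization A => (WithLp.ofLp x).fst := by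
  refine (LipschitzWith.of_dist_le_mul (K := 1) fun x y => ?_).continuous
  rw [dist_eq_norm, dist_eq_norm, WithLp.unitization_norm_def (x - y), NNReal.coe_one, one_mul]
  exact le_add_of_nonneg_right (norm_nonneg _)

omit [StarRing A] [StarModule ℂ A] in
theorem continuous_l1Unitization_snd :
    Continuous fun x : L1Unitization A => (WithLp.ofLp x).snd := by
  refine (LipschitzWith.of_dist_le_mul (K := 1) fun x y => ?_).continuous
  rw [dist_eq_norm, dist_eq_norm, WithLp.unitization_norm_def (x - y), NNReal.coe_one, one_mul]
  exact le_add_of_nonneg_left (norm_nonneg _)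

instance [ContinuousStar A] : ContinuousStar (L1Unitization A) where
  continuous_star := continuous_iff_continuousAt.mpr fun x => by
    rw [ContinuousAt, tendsto_iff_norm_sub_tendsto_zero]
    have h1 : Continuous fun y : L1Unitization A =>
        ‖star (WithLp.ofLp y).fst - star (WithLp.ofLp x).fst‖ +
          ‖star (WithLp.ofLp y).snd - star (WithLp.ofLp x).snd‖ :=
      ((continuous_l1Unitization_fst.star.sub continuous_const).norm).add
        ((continuous_l1Unitization_snd.star.sub continuous_const).norm)
    have h2 := h1.tendsto x
    simp only [sub_self, norm_zero, add_zero] at h2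
    refine h2.congr fun y => ?_
    rw [WithLp.unitization_norm_def]
    rfl

omit [StarRing A] [StarModule ℂ A] in
theorem toL1_injective : Function.Injective (toL1 : A → L1Unitization A) := fun _ _ h =>
  Unitization.inr_injective (R := ℂ) (congrArg WithLp.ofLp h)

omit [StarRing A] [StarModule ℂ A] in
theorem toL1_mul (a b : A) : toL1 (a * b) = toL1 a * toL1 b := by
  apply WithLp.ofLp_injective 1
  simp [toL1]

omit [StarRing A] [StarModule ℂ A] in
theorem toL1_add (a b : A) : toL1 (a + b) = toL1 a + toL1 b := by
  apply WithLp.ofLp_injective 1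
  simp [toL1]

omit [StarRing A] [StarModule ℂ A] in
theorem toL1_sub (a b : A) : toL1 (a - b) = toL1 a - toL1 b := by
  apply WithLp.ofLp_injective 1
  simp [toL1]

omit [StarRing A] [StarModule ℂ A] in
theorem toL1_smul (c : ℂ) (a : A) : toL1 (c • a) = c • toL1 a := by
  apply WithLp.ofLp_injective 1
  simp [toL1]

theorem toL1_star (a : A) : toL1 (star a) = star (toL1 a) := by
  apply WithLp.ofLp_injective 1
  change ((star a : A) : Unitization ℂ A) = star (a : Unitization ℂ A)
  simp

omit [StarRing A] [StarModule ℂ A] in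
theorem norm_toL1 (a : A) : ‖toL1 a‖ = ‖a‖ := WithLp.unitization_norm_inr a

instance : NormOneClass (L1Unitization A) where
  norm_one := by
    rw [WithLp.unitization_norm_def]
    change ‖(1 : ℂ)‖ + ‖(0 : A)‖ = 1
    simp

omit [StarModule ℂ A] in
theorem spectralRadius_starRep_le [CompleteSpace A] (ρ : StarRep A) (a : A) :
    spectralRadius ℂ (ρ.π a) ≤ spectralRadius ℂ (toL1 a) := by
  let Φ : L1Unitization A →ₐ[ℂ] (ρ.H →L[ℂ] ρ.H) :=
    (Unitization.lift (ρ.π : A →ₙₐ[ℂ] (ρ.H →L[ℂ] ρ.H))).comp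
      (WithLp.unitizationAlgEquiv ℂ (𝕜 := ℂ) (A := A)).toAlgHom
  have hΦ : Φ (toL1 a) = ρ.π a := by
    simp [Φ, toL1]
    rfl
  rw [← hΦ]
  exact biSup_mono fun z hz => AlgHom.spectrum_apply_subset Φ _ hz

-- By the C*-identity, `‖ρ a‖²` is the spectral radius of `ρ (a⋆ a)`, and homomorphisms do not
-- increase the spectral radius.
omit [StarModule ℂ A] in
theorem starRep_eq_zero_of_spectralRadius [CompleteSpace A] (ρ : StarRep A) {a : A}
    (h : spectralRadius ℂ (toL1 (star a * a)) = 0) : ρ.π a = 0 := by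
  have hsa : IsSelfAdjoint (ρ.π (star a * a)) := (IsSelfAdjoint.star_mul_self a).map ρ.π
  have h1 : (‖ρ.π (star a * a)‖₊ : ℝ≥0∞) = 0 := by
    rw [← hsa.spectralRadius_eq_nnnorm, ← nonpos_iff_eq_zero, ← h]
    exact spectralRadius_starRep_le ρ _
  rw [map_mul, map_star] at h1
  simpa using h1

/-- The involution of a `*`-semisimple Banach `*`-algebra is continuous. -/
theorem continuousStar_of_isStarSemisimple [CompleteSpace A] (hss : IsStarSemisimple A) :
    ContinuousStar A := by
  -- The separating space of the involution; by the closed graph theorem, continuity amounts to its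
  -- vanishing.
  let Sep : A → Prop := fun b => ∃ a : ℕ → A, Tendsto a atTop (𝓝 0) ∧
    Tendsto (fun n => star (a n)) atTop (𝓝 b)
  have hmul : ∀ x b, Sep b → Sep (x * b) := by
    rintro x b ⟨a, h0, hb⟩
    refine ⟨fun n => a n * star x, by simpa using h0.mul_const (star x), ?_⟩
    simpa using hb.const_mul x
  have hrad : ∀ b, Sep b → spectralRadius ℂ (toL1 b) = 0 := by
    rintro b ⟨a, h0, hb⟩
    set M : ℝ := ‖star b‖ + 1
    have hM : 0 < M := by positivity
    -- Three circles with `p = (a n)⋆` and `q = b - (a n)⋆`, so `p + q = b`. The adjoint of `z • p +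
    -- q` tends to `b⋆` in norm, uniformly on `|z| = R`, which explains `M`. First `n → ∞`, then `R
    -- → ∞`.
    have key : ∀ R : ℝ, 1 < R → spectralRadius ℂ (toL1 b) ^ 2 ≤ ENNReal.ofReal (M * (‖b‖ / R)) := by
      intro R hR
      have hlim : Tendsto (fun n => ENNReal.ofReal (M * (‖star (a n)‖ / R + ‖b - star (a n)‖))) atTop
          (𝓝 (ENNReal.ofReal (M * (‖b‖ / R + ‖b - b‖)))) :=
        ENNReal.tendsto_ofReal ((((hb.norm.div_const R).add (hb.const_sub b).norm)).const_mul M)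
      rw [sub_self, norm_zero, add_zero] at hlim
      refine ge_of_tendsto hlim ?_
      have hlim2 : Tendsto (fun n => R * ‖a n‖ + ‖star b - a n‖) atTop (𝓝 (R * ‖(0 : A)‖ + ‖star b - 0‖)) :=
        (h0.norm.const_mul R).add (h0.const_sub _).norm
      rw [norm_zero, mul_zero, zero_add, sub_zero] at hlim2
      filter_upwards [hlim2.eventually_lt_const (show ‖star b‖ < M by simp [M])] with n hn
      have h3 := spectralRadius_add_sq_le (p := toL1 (star (a n))) (q := toL1 (b - star (a n)))
        hR hM.le fun z hz => by
          rw [← spectralRadius_star, star_add, star_smul, ← toL1_star, ← toL1_star, star_star,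
            star_sub, star_star]
          refine (spectrum.spectralRadius_le_nnnorm _).trans_lt ?_
          rw [← ENNReal.ofReal_coe_nnreal, coe_nnnorm, ENNReal.ofReal_lt_ofReal_iff hM]
          refine lt_of_le_of_lt ((norm_add_le _ _).trans_eq ?_) hn
          rw [norm_smul, norm_toL1, norm_toL1, norm_star, hz]
      rw [norm_toL1, norm_toL1, ← toL1_add] at h3
      simpa using h3
    have hlim : Tendsto (fun R : ℝ => ENNReal.ofReal (M * (‖b‖ / R))) atTop (𝓝 (ENNReal.ofReal (M * 0))) :=
      ENNReal.tendsto_ofReal ((tendsto_const_nhds.div_atTop tendsto_id).const_mul M)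
    have := ge_of_tendsto hlim ((eventually_gt_atTop 1).mono key)
    simpa using this
  -- The separating space is stable under left multiplication, so `b⋆ b` also has spectral radius
  -- `0`.
  have hzero : ∀ b, Sep b → b = 0 := fun b hb => hss b fun ρ _ =>
    starRep_eq_zero_of_spectralRadius ρ (hrad _ (hmul _ _ hb))
  let T : A →ₗ[ℝ] A :=
    { toFun := star
      map_add' := star_add
      map_smul' := fun c a => by
        rw [← Complex.coe_smul, ← Complex.coe_smul, star_smul]; simp }
  refine ⟨T.continuous_of_seq_closed_graph fun v x y hx hy => ?_⟩
  have := hzero (y - star x) ⟨fun n => v n - x, by simpa using hx.sub_const x, by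
    simpa [T] using hy.sub_const (star x)⟩
  exact sub_eq_zero.mp this

end UnitizationStar

/-! ### Hermitian unital Banach `*`-algebras -/

section Hermitian

variable {B : Type*} [NormedRing B] [NormedAlgebra ℂ B] [StarRing B] [StarModule ℂ B]

variable (B) in
/-- A unital algebra is hermitian if its self-adjoint elements have real spectrum. -/
def UnitalHermitian : Prop :=
  ∀ h : B, IsSelfAdjoint h → ∀ z : ℂ, z.im ≠ 0 → IsUnit (algebraMap ℂ B z - h)

/-- A self-adjoint element without strictly negative spectral values. -/
def SpectrallyNonneg (h : B) : Prop :=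
  IsSelfAdjoint h ∧ ∀ t : ℝ, 0 < t → IsUnit (h + algebraMap ℝ B t)

omit [StarRing B] [StarModule ℂ B] in
theorem spectralRadius_mul_comm (a b : B) :
    spectralRadius ℂ (a * b) = spectralRadius ℂ (b * a) := by
  have : ∀ a b : B, spectralRadius ℂ (a * b) ≤ spectralRadius ℂ (b * a) := fun a b =>
    iSup₂_le fun z hz => by
      rcases eq_or_ne z 0 with rfl | h0
      · simp
      · have hz' : z ∈ spectrum ℂ (b * a) \ {0} := by
          rw [← spectrum.nonzero_mul_comm]; exact ⟨hz, h0⟩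
        exact le_iSup₂ (f := fun (k : ℂ) (_ : k ∈ spectrum ℂ (b * a)) => (‖k‖₊ : ℝ≥0∞)) z hz'.1
  exact (this a b).antisymm (this b a)

omit [StarRing B] [StarModule ℂ B] in
theorem spectralRadius_smul_le {c : ℂ} (hc : ‖c‖ ≤ 1) (a : B) :
    spectralRadius ℂ (c • a) ≤ spectralRadius ℂ a := by
  rcases eq_or_ne c 0 with rfl | h0
  · simp
  refine iSup₂_le fun z hz => ?_
  have hz' : z ∈ spectrum ℂ (Units.mk0 c h0 • a) := hz
  rw [spectrum.unit_smul_eq_smul] at hz'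
  obtain ⟨w, hw, rfl⟩ := hz'
  refine le_trans ?_ (le_iSup₂ (f := fun (k : ℂ) (_ : k ∈ spectrum ℂ a) => (‖k‖₊ : ℝ≥0∞)) w hw)
  have : ‖Units.mk0 c h0 • w‖₊ ≤ ‖w‖₊ := by
    change ‖c * w‖ ≤ ‖w‖
    rw [norm_mul]
    exact mul_le_of_le_one_left (norm_nonneg _) hc
  exact_mod_cast this

omit [StarRing B] [StarModule ℂ B] in
theorem isUnit_one_sub_of_spectralRadius_lt_one {a : B} (h : spectralRadius ℂ a < 1) :
    IsUnit (1 - a) := by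
  have := spectrum.mem_resolventSet_of_spectralRadius_lt (𝕜 := ℂ) (a := a) (k := 1) (by simpa using h)
  simpa [spectrum.mem_resolventSet_iff] using this

omit [StarRing B] [StarModule ℂ B] in
theorem spectralRadius_lt_one_of_forall [CompleteSpace B] {a : B}
    (h : ∀ z : ℂ, 1 ≤ ‖z‖ → IsUnit (algebraMap ℂ B z - a)) : spectralRadius ℂ a < 1 := by
  rcases subsingleton_or_nontrivial B with hs | hn
  · simp
  refine spectrum.spectralRadius_lt_of_forall_lt (r := 1) a fun z hz => ?_
  by_contra! hz1
  exact hz (h z (by exact_mod_cast hz1))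

/-- Skew-adjoint elements are `i` times self-adjoint ones, so their spectrum is imaginary and misses
`-1`. -/
theorem UnitalHermitian.isUnit_one_add (hB : UnitalHermitian B) {k : B} (hk : star k = -k) :
    IsUnit (1 + k) := by
  have h1 : IsSelfAdjoint (-(Complex.I • k)) := by
    rw [IsSelfAdjoint, star_neg, star_smul, hk]
    simp
  have h2 := hB _ h1 Complex.I (by simp)
  have h3 : algebraMap ℂ B Complex.I - -(Complex.I • k) = Complex.I • (1 + k) := by
    rw [Algebra.algebraMap_eq_smul_one]; module
  rw [h3] at h2
  have := h2.smul (Units.mk0 (-Complex.I) (by simp))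
  simpa [Units.smul_def, smul_smul] using this

theorem UnitalHermitian.isUnit_mul_self_add (hB : UnitalHermitian B) {u k : B}
    (hu : IsSelfAdjoint u) (huu : IsUnit u) (hk : star k = -k) : IsUnit (u * u + k) := by
  obtain ⟨u, rfl⟩ := huu
  have hv : star (↑u⁻¹ : B) = ↑u⁻¹ := by
    have : star u = u := Units.ext hu
    rw [← Units.coe_star_inv, this]
  have h := hB.isUnit_one_add (k := ↑u⁻¹ * k * ↑u⁻¹) (by
    rw [star_mul, star_mul, hv, hk]; noncomm_ring)
  have h2 : (u * u + k : B) = u * (1 + ↑u⁻¹ * k * ↑u⁻¹) * u := by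
    rw [mul_add, add_mul, mul_one, mul_assoc, mul_assoc (_ * k), Units.inv_mul, mul_one,
      Units.mul_inv_cancel_left]
  rw [h2]
  exact (u.isUnit.mul h).mul u.isUnit

variable [CompleteSpace B] [ContinuousStar B]

/-- Pták's inequality, in the form needed here. -/
theorem UnitalHermitian.isUnit_one_sub (hB : UnitalHermitian B) {x : B}
    (hx : spectralRadius ℂ (star x * x) < 1) : IsUnit (1 - x) := by
  -- Here `1 - y⋆ y` is the square of an invertible self-adjoint element, and adding a skew-adjoint
  -- element keeps it invertible.
  have key : ∀ y : B, spectralRadius ℂ (star y * y) < 1 → ∀ k, star k = -k →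
      IsUnit (1 - star y * y + k) := fun y hy k hk => by
    obtain ⟨u, hu, huu⟩ := exists_isSelfAdjoint_mul_self_eq (IsSelfAdjoint.star_mul_self y) hy
    rw [← huu]
    refine hB.isUnit_mul_self_add hu ?_ hk
    have := isUnit_one_sub_of_spectralRadius_lt_one hy
    rw [← huu, (Commute.refl u).isUnit_mul_iff] at this
    exact this.1
  have h1 := key x hx (star x - x) (by simp)
  have h2 := key (star x) (by rwa [star_star, spectralRadius_mul_comm]) (star x - x) (by simp)
  rw [star_star] at h2
  -- For the skew element `x⋆ - x` both expressions factor: one yields a left inverse of `1 - x`,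
  -- the other a right inverse.
  have e1 : 1 - star x * x + (star x - x) = (1 + star x) * (1 - x) := by noncomm_ring
  have e2 : 1 - x * star x + (star x - x) = (1 - x) * (1 + star x) := by noncomm_ring
  rw [e1] at h1
  rw [e2] at h2
  obtain ⟨v, hv⟩ := h1.exists_left_inv
  obtain ⟨w, hw⟩ := h2.exists_right_inv
  exact isUnit_iff_exists_and_exists.mpr ⟨⟨_, by rw [← mul_assoc, hw]⟩, ⟨_, by rw [mul_assoc, hv]⟩⟩

theorem UnitalHermitian.spectralRadius_lt_one (hB : UnitalHermitian B) {x : B}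
    (hx : spectralRadius ℂ (star x * x) < 1) : spectralRadius ℂ x < 1 := by
  refine spectralRadius_lt_one_of_forall fun z hz => ?_
  have hz0 : z ≠ 0 := norm_pos_iff.mp (one_pos.trans_le hz)
  have h1 : IsUnit (1 - z⁻¹ • x) := by
    refine hB.isUnit_one_sub (lt_of_le_of_lt ?_ hx)
    rw [star_smul, smul_mul_smul_comm]
    refine spectralRadius_smul_le ?_ _
    rw [norm_mul, norm_star, norm_inv]
    exact mul_le_one₀ (inv_le_one_of_one_le₀ hz) (by positivity) (inv_le_one_of_one_le₀ hz)
  have := h1.smul (Units.mk0 z hz0)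
  convert this using 1
  rw [Units.smul_mk0, smul_sub, smul_smul, mul_inv_cancel₀ hz0, one_smul,
    Algebra.algebraMap_eq_smul_one]

/-- Since `(hk)⋆(hk) = k h² k` has the same spectral radius as `h² k²`, Pták's inequality reduces
`(h, k)` to `(h², k²)`. After enough squarings both powers have norm below `1`. -/
theorem UnitalHermitian.spectralRadius_mul_lt_one (hB : UnitalHermitian B) {h k : B}
    (hh : IsSelfAdjoint h) (hk : IsSelfAdjoint k) (hrh : spectralRadius ℂ h < 1)
    (hrk : spectralRadius ℂ k < 1) : spectralRadius ℂ (h * k) < 1 := by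
  have key : ∀ n : ℕ, ∀ h k : B, IsSelfAdjoint h → IsSelfAdjoint k →
      ‖h ^ 2 ^ n * k ^ 2 ^ n‖ < 1 → spectralRadius ℂ (h * k) < 1 := by
    intro n
    induction n with
    | zero =>
      intro h k _ _ hn
      have := spectralRadius_pow_le_of_norm_pow_le (a := h * k) one_ne_zero (norm_nonneg _)
        (by rw [pow_one, pow_one])
      refine this.trans_lt ?_
      rw [← ENNReal.ofReal_one]
      exact (ENNReal.ofReal_lt_ofReal_iff one_pos).mpr (by simpa using hn)
    | succ n ih =>
      intro h k hh hk hn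
      refine hB.spectralRadius_lt_one ?_
      have := ih (h ^ 2) (k ^ 2) (hh.pow 2) (hk.pow 2) (by
        rwa [← pow_mul, ← pow_mul, ← pow_succ'])
      have e : star (h * k) * (h * k) = k * (h * h * k) := by
        rw [star_mul, hh.star_eq, hk.star_eq]; noncomm_ring
      rw [e, spectralRadius_mul_comm, mul_assoc, ← sq, ← sq]
      exact this
  have h1 : ∀ a : B, spectralRadius ℂ a < 1 → ∀ᶠ n : ℕ in atTop, ‖a ^ 2 ^ n‖ < 1 := fun a ha => by
    have := eventually_norm_pow_lt_of_spectralRadius_lt (M := 1) (a := a) (by simpa using ha)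
    simp only [one_pow] at this
    exact (tendsto_pow_atTop_atTop_of_one_lt one_lt_two).eventually this
  obtain ⟨n, hn1, hn2⟩ := ((h1 h hrh).and (h1 k hrk)).exists
  exact key n h k hh hk ((norm_mul_le _ _).trans_lt
    (mul_lt_one_of_nonneg_of_lt_one_left (norm_nonneg _) hn1 hn2.le))

end Hermitian

/-! ### The positive cone of a hermitian algebra -/

section Cone

variable {B : Type*} [NormedRing B] [NormedAlgebra ℂ B] [StarRing B] [StarModule ℂ B]

omit [StarModule ℂ B] in
theorem UnitalHermitian.isUnit_add (hB : UnitalHermitian B) {h : B} (hh : IsSelfAdjoint h) {w : ℂ}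
    (hw : w.im ≠ 0) : IsUnit (h + algebraMap ℂ B w) := by
  have := (hB h hh (-w) (by simpa using hw)).neg
  rwa [map_neg, neg_sub, sub_neg_eq_add] at this

omit [StarModule ℂ B] in
theorem SpectrallyNonneg.isUnit_add (hB : UnitalHermitian B) {h : B} (hh : SpectrallyNonneg h)
    {w : ℂ} (hw : w.im = 0 → 0 < w.re) : IsUnit (h + algebraMap ℂ B w) := by
  by_cases h0 : w.im = 0
  · have := hh.2 w.re (hw h0)
    have e : algebraMap ℝ B w.re = algebraMap ℂ B w := by
      rw [IsScalarTower.algebraMap_apply ℝ ℂ B, Complex.coe_algebraMap]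
      congr 1
      exact Complex.ext rfl (by simp [h0])
    rwa [e] at this
  · exact hB.isUnit_add hh.1 h0

theorem SpectrallyNonneg.smul {h : B} (hh : SpectrallyNonneg h) {t : ℝ} (ht : 0 < t) :
    SpectrallyNonneg (t • h) := by
  refine ⟨IsSelfAdjoint.smul (by simp [IsSelfAdjoint]) hh.1, fun s hs => ?_⟩
  have := (hh.2 (s / t) (by positivity)).smul (Units.mk0 t ht.ne')
  rwa [Units.smul_mk0, smul_add, Algebra.algebraMap_eq_smul_one, smul_smul,
    mul_div_cancel₀ _ ht.ne', ← Algebra.algebraMap_eq_smul_one] at this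

theorem SpectrallyNonneg.add_algebraMap {h : B} (hh : SpectrallyNonneg h) {t : ℝ} (ht : 0 ≤ t) :
    SpectrallyNonneg (h + algebraMap ℝ B t) := by
  refine ⟨hh.1.add (IsSelfAdjoint.algebraMap B (by simp [IsSelfAdjoint])), fun s hs => ?_⟩
  rw [add_assoc, ← map_add]
  exact hh.2 _ (by positivity)

omit [StarModule ℂ B] in
theorem UnitalHermitian.spectrallyNonneg_mul_self (hB : UnitalHermitian B) {h : B}
    (hh : IsSelfAdjoint h) : SpectrallyNonneg (h * h) := by
  refine ⟨(hh.commute_iff hh).mp rfl, fun t ht => ?_⟩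
  have hs : 0 < √t := Real.sqrt_pos.mpr ht
  have h1 := hB.isUnit_add hh (w := √t * Complex.I) (by simpa using hs.ne')
  have h2 := hB.isUnit_add hh (w := -(√t * Complex.I)) (by simpa using hs.ne')
  have e : h * h + algebraMap ℝ B t =
      (h + algebraMap ℂ B (√t * Complex.I)) * (h + algebraMap ℂ B (-(√t * Complex.I))) := by
    have e1 : algebraMap ℝ B t = -(algebraMap ℂ B (√t * Complex.I) * algebraMap ℂ B (√t * Complex.I)) := by
      rw [← map_mul, ← map_neg, IsScalarTower.algebraMap_apply ℝ ℂ B, Complex.coe_algebraMap]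
      congr 1
      rw [mul_mul_mul_comm, Complex.I_mul_I, ← Complex.ofReal_mul, Real.mul_self_sqrt ht.le]
      simp
    rw [e1, map_neg, mul_add, add_mul, add_mul, mul_neg, mul_neg,
      Algebra.commutes (√t * Complex.I : ℂ) h]
    abel
  rw [e]
  exact h1.mul h2

section

variable [CompleteSpace B]

omit [StarRing B] [StarModule ℂ B] in
theorem isUnit_add_algebraMap_of_norm_lt {k : B} {t : ℝ} (h : ‖k‖ < t) :
    IsUnit (k + algebraMap ℝ B t) := by
  have ht : 0 < t := (norm_nonneg k).trans_lt h
  have h1 : IsUnit (1 - -(t⁻¹ • k)) := by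
    refine isUnit_one_sub_of_norm_lt_one ?_
    rwa [norm_neg, norm_smul, norm_inv, Real.norm_of_nonneg ht.le, inv_mul_lt_one₀ ht]
  have := h1.smul (Units.mk0 t ht.ne')
  rwa [Units.smul_mk0, sub_neg_eq_add, smul_add, smul_smul, mul_inv_cancel₀ ht.ne', one_smul,
    ← Algebra.algebraMap_eq_smul_one, add_comm] at this

theorem spectrallyNonneg_add_algebraMap_of_norm_le {k : B} (hk : IsSelfAdjoint k) {t : ℝ}
    (h : ‖k‖ ≤ t) : SpectrallyNonneg (k + algebraMap ℝ B t) := by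
  refine ⟨hk.add (IsSelfAdjoint.algebraMap B (by simp [IsSelfAdjoint])), fun s hs => ?_⟩
  rw [add_assoc, ← map_add]
  exact isUnit_add_algebraMap_of_norm_lt (by linarith)

-- The function `1 - 1/(1+t) = t/(1+t)` maps `[0, ∞)` into `[0, 1)`.
omit [StarModule ℂ B] in
theorem SpectrallyNonneg.exists_inverse (hB : UnitalHermitian B) {h : B} (hh : SpectrallyNonneg h) :
    ∃ g : B, IsSelfAdjoint g ∧ (1 + h) * g = 1 ∧ g * (1 + h) = 1 ∧ spectralRadius ℂ (1 - g) < 1 := by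
  obtain ⟨v, hv⟩ : IsUnit (1 + h) := by simpa [add_comm] using hh.2 1 one_pos
  have hvs : star v = v := Units.ext (by
    rw [Units.coe_star, hv, star_add, star_one, hh.1.star_eq])
  refine ⟨↑v⁻¹, ?_, by rw [← hv]; simp, by rw [← hv]; simp, ?_⟩
  · rw [IsSelfAdjoint, ← Units.coe_star_inv, hvs]
  · refine spectralRadius_lt_one_of_forall fun z hz => ?_
    have e : algebraMap ℂ B z - (1 - ↑v⁻¹) = (z • (1 : B) + (z - 1) • h) * ↑v⁻¹ := by
      rw [Units.eq_mul_inv_iff_mul_eq, sub_mul, sub_mul, Units.inv_mul, hv,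
        Algebra.algebraMap_eq_smul_one, smul_mul_assoc, one_mul]
      module
    rw [e]
    refine IsUnit.mul ?_ (v⁻¹).isUnit
    rcases eq_or_ne z 1 with rfl | h1
    · simp
    · have h1' : z - 1 ≠ 0 := sub_ne_zero.mpr h1
      -- If `z / (z - 1)` were a real `s ≤ 0`, then `|z| = |s| / (1 + |s|) < 1`.
      have hw : IsUnit (h + algebraMap ℂ B (z / (z - 1))) := hh.isUnit_add hB fun him => by
        by_contra! hre
        set s := (z / (z - 1)).re
        have hs : z / (z - 1) = (s : ℂ) := Complex.ext rfl (by simpa using him)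
        rw [div_eq_iff h1'] at hs
        have e2 : z * ((1 - s : ℝ) : ℂ) = ((-s : ℝ) : ℂ) := by
          push_cast; linear_combination hs
        have e3 := congrArg norm e2
        rw [norm_mul, Complex.norm_real, Complex.norm_real, Real.norm_of_nonneg (by linarith),
          Real.norm_of_nonneg (by linarith)] at e3
        nlinarith
      have := hw.smul (Units.mk0 _ h1')
      rw [Units.smul_mk0, smul_add, Algebra.algebraMap_eq_smul_one, smul_smul,
        mul_div_cancel₀ _ h1', add_comm] at this
      exact this

variable [ContinuousStar B]

/-- With `g = (1+h)⁻¹` and `f = (1+k)⁻¹` the sum factors as `(1+h) (1 - (1-g)(1-f)) (1+k)`, and the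
middle factor is invertible by the product estimate for spectral radii. -/
theorem SpectrallyNonneg.isUnit_one_add_add (hB : UnitalHermitian B) {h k : B}
    (hh : SpectrallyNonneg h) (hk : SpectrallyNonneg k) : IsUnit (1 + h + k) := by
  obtain ⟨g, hg, hg1, hg2, hgr⟩ := hh.exists_inverse hB
  obtain ⟨f, hf, hf1, hf2, hfr⟩ := hk.exists_inverse hB
  have h1 := isUnit_one_sub_of_spectralRadius_lt_one (hB.spectralRadius_mul_lt_one
    ((IsSelfAdjoint.one B).sub hg) ((IsSelfAdjoint.one B).sub hf) hgr hfr)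
  have uh : IsUnit (1 + h) := isUnit_iff_exists.mpr ⟨g, hg1, hg2⟩
  have uk : IsUnit (1 + k) := isUnit_iff_exists.mpr ⟨f, hf1, hf2⟩
  have e : 1 + h + k = (1 + h) * (1 - (1 - g) * (1 - f)) * (1 + k) := by
    have e1 : (1 + h) * (1 - g) = h := by rw [mul_sub, hg1]; noncomm_ring
    have e2 : (1 - f) * (1 + k) = k := by rw [sub_mul, hf2]; noncomm_ring
    have e3 : (1 + h) * (1 - (1 - g) * (1 - f)) * (1 + k) =
        (1 + h) * (1 + k) - ((1 + h) * (1 - g)) * ((1 - f) * (1 + k)) := by noncomm_ring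
    rw [e3, e1, e2]; noncomm_ring
  rw [e]
  exact (uh.mul h1).mul uk

theorem SpectrallyNonneg.add (hB : UnitalHermitian B) {h k : B}
    (hh : SpectrallyNonneg h) (hk : SpectrallyNonneg k) : SpectrallyNonneg (h + k) := by
  refine ⟨hh.1.add hk.1, fun t ht => ?_⟩
  have := (SpectrallyNonneg.isUnit_one_add_add hB (hh.smul (inv_pos.mpr ht))
    (hk.smul (inv_pos.mpr ht))).smul (Units.mk0 t ht.ne')
  rw [Units.smul_mk0, smul_add, smul_add, smul_smul, smul_smul, mul_inv_cancel₀ ht.ne', one_smul,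
    one_smul, ← Algebra.algebraMap_eq_smul_one] at this
  convert this using 1
  abel

/-- The key step of the Shirali–Ford theorem: a gap in the spectrum of `x⋆ * x`. -/
theorem UnitalHermitian.isUnit_star_mul_self_add_half (hB : UnitalHermitian B) (x : B)
    (hx : ∀ t : ℝ, 1 ≤ t → IsUnit (star x * x + algebraMap ℝ B t)) :
    IsUnit (star x * x + algebraMap ℝ B 2⁻¹) := by
  set c := star x * x with hc
  have hcs : IsSelfAdjoint c := IsSelfAdjoint.star_mul_self x
  obtain ⟨v, hv⟩ : IsUnit (1 + c) := by simpa [add_comm] using hx 1 le_rfl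
  have hvs : star v = v := Units.ext (by
    rw [Units.coe_star, hv, star_add, star_one, hcs.star_eq])
  set g : B := ↑v⁻¹ with hg
  have hgs : star g = g := by rw [hg, ← Units.coe_star_inv, hvs]
  have hvg : (1 + c) * g = 1 := by rw [← hv]; simp [hg]
  have hgv : g * (1 + c) = 1 := by rw [← hv]; simp [hg]
  have hcg : c * g = g * c := by
    have : (1 + c) * g = g * (1 + c) := hvg.trans hgv.symm
    rw [add_mul, mul_add, one_mul, mul_one] at this
    exact add_left_cancel this
  -- Chosen so that `y⋆ y = 4c/(1+c)²` and `1 - y⋆ y = ((1-c)/(1+c))²`.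
  set y : B := (2 : ℝ) • (x * g) with hy
  have hyy : star y * y = (4 : ℝ) • (c * g * g) := by
    rw [hy, star_smul, star_mul, hgs, smul_mul_smul_comm]
    have : g * star x * (x * g) = c * g * g := by rw [hcg, hc]; noncomm_ring
    rw [this]
    congr 1
    norm_num
  have hone : 1 = (1 + c) * (1 + c) * (g * g) := by
    rw [mul_assoc, ← mul_assoc (1 + c) g g, hvg, one_mul, hvg]
  -- `1 - y⋆ y` is a square
  have h1 : SpectrallyNonneg (1 - star y * y) := by
    have hs : IsSelfAdjoint ((1 - c) * g) := by
      rw [IsSelfAdjoint, star_mul, hgs, star_sub, star_one, hcs.star_eq, sub_mul, mul_sub, hcg,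
        one_mul, mul_one]
    have := hB.spectrallyNonneg_mul_self hs
    have e : (1 - c) * g * ((1 - c) * g) = 1 - star y * y := by
      have e1 : (1 - c) * g * ((1 - c) * g) = (1 - c) * (g * (1 - c)) * g := by noncomm_ring
      have e2 : g * (1 - c) = (1 - c) * g := by
        rw [sub_mul, mul_sub, hcg, one_mul, mul_one]
      have e3 : (1 - c) * ((1 - c) * g) * g =
          (1 + c) * (1 + c) * (g * g) - (4 : ℝ) • (c * g * g) := by
        rw [show (4 : ℝ) • (c * g * g) = 4 * (c * g * g) by
          rw [← Nat.cast_ofNat (R := ℝ), Nat.cast_smul_eq_nsmul, nsmul_eq_mul, Nat.cast_ofNat]]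
        noncomm_ring
      rw [e1, e2, e3, ← hone, hyy]
    rwa [e] at this
  -- `y y⋆` and `y⋆ y` have the same nonzero spectrum.
  have h2 : SpectrallyNonneg (1 - y * star y) := by
    refine ⟨(IsSelfAdjoint.one B).sub (IsSelfAdjoint.mul_star_self y), fun t ht => ?_⟩
    have e : ∀ w : B, 1 - w + algebraMap ℝ B t = algebraMap ℝ B (1 + t) - w := fun w => by
      rw [map_add, map_one]; abel
    have := h1.2 t ht
    rw [e, ← spectrum.notMem_iff] at this ⊢
    exact fun h => this (spectrum.unit_mem_mul_comm (r := Units.mk0 (1 + t) (by positivity))|>.mp h)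
  -- Add `1 - y y⋆` to `y y⋆ + y⋆ y`, which is half a sum of two squares of self-adjoint elements.
  have h3 : SpectrallyNonneg (star y * y + 1) := by
    have ha : IsSelfAdjoint (y + star y) := IsSelfAdjoint.add_star_self y
    have hb : IsSelfAdjoint (Complex.I • (y - star y)) := by
      rw [IsSelfAdjoint, star_smul, star_sub, star_star]
      simp only [RCLike.star_def, Complex.conj_I]
      module
    have h4 := ((hB.spectrallyNonneg_mul_self ha).add hB (hB.spectrallyNonneg_mul_self hb)).smul
      (t := 2⁻¹) (by norm_num)
    have h5 := h4.add hB h2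
    have e : (2⁻¹ : ℝ) • ((y + star y) * (y + star y) +
        Complex.I • (y - star y) * Complex.I • (y - star y)) = y * star y + star y * y := by
      rw [smul_mul_smul_comm, Complex.I_mul_I]
      have : (y + star y) * (y + star y) + (-1 : ℂ) • ((y - star y) * (y - star y)) =
          (2 : ℝ) • (y * star y + star y * y) := by
        rw [neg_one_smul, two_smul]; noncomm_ring
      rw [this, smul_smul]
      norm_num
    rw [e] at h5
    convert h5 using 1
    abel
  -- The value `4t/(1+t)²` at `t = -1/2` is `-8`, below the bound `-1` just obtained, so `y⋆ y + 8`
  -- is invertible; it has `c + 1/2` as a factor.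
  have h4 := h3.2 7 (by norm_num)
  have e : star y * y + 1 + algebraMap ℝ B 7 =
      (8 : ℝ) • ((c + algebraMap ℝ B 2⁻¹) * ((c + algebraMap ℝ B 2) * (g * g))) := by
    have : star y * y + 1 + algebraMap ℝ B 7 = (4 : ℝ) • (c * g * g) +
        (8 : ℝ) • ((1 + c) * (1 + c) * (g * g)) := by
      rw [← hone, hyy, Algebra.algebraMap_eq_smul_one]; module
    rw [this, ← mul_assoc _ _ (g * g), mul_assoc c g g]
    rw [← smul_mul_assoc, ← smul_mul_assoc, ← smul_mul_assoc, ← add_mul]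
    simp only [Algebra.algebraMap_eq_smul_one, mul_add, add_mul, one_mul, mul_one,
      smul_mul_assoc, mul_smul_comm]
    module
  rw [e] at h4
  have h5 := h4.smul (Units.mk0 (8⁻¹ : ℝ) (by norm_num))
  rw [Units.smul_mk0, smul_smul, inv_mul_cancel₀ (by norm_num), one_smul] at h5
  have hcomm : Commute (c + algebraMap ℝ B 2⁻¹) ((c + algebraMap ℝ B 2) * (g * g)) := by
    have hc1 : Commute c g := hcg
    refine Commute.add_left ?_ (Algebra.commute_algebraMap_left _ _)
    exact ((Commute.refl c).add_right (Algebra.commute_algebraMap_right _ _)).mul_right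
      (hc1.mul_right hc1)
  exact (hcomm.isUnit_mul_iff.mp h5).1

/-- The Shirali–Ford theorem. -/
theorem UnitalHermitian.spectrallyNonneg_star_mul_self (hB : UnitalHermitian B) (x : B) :
    SpectrallyNonneg (star x * x) := by
  refine ⟨IsSelfAdjoint.star_mul_self x, fun t ht => ?_⟩
  by_contra hne
  set c := star x * x with hc
  -- Take the most negative spectral value `-m` and rescale `x` by `r⁻¹` with `r² = 2m`: this value
  -- moves to `-1/2`, nothing remains at or below `-1`, and the gap lemma gives a contradiction.
  let K : Set ℝ := {s | t ≤ s ∧ ¬ IsUnit (c + algebraMap ℝ B s)}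
  have hK : IsCompact K := by
    refine Metric.isCompact_of_isClosed_isBounded ?_ ?_
    · refine (isClosed_Ici (a := t)).inter ?_
      have : IsOpen {s : ℝ | IsUnit (c + algebraMap ℝ B s)} :=
        Units.isOpen.preimage (continuous_const.add (continuous_algebraMap ℝ B))
      exact this.isClosed_compl
    · refine (Metric.isBounded_Icc t ‖c‖).subset fun s hs => ⟨hs.1, ?_⟩
      by_contra! h
      exact hs.2 (isUnit_add_algebraMap_of_norm_lt h)
  obtain ⟨m, ⟨hm, hmn⟩, hmax⟩ := hK.exists_isGreatest ⟨t, le_rfl, hne⟩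
  have hm0 : 0 < m := ht.trans_le hm
  have hunit : ∀ s, m < s → IsUnit (c + algebraMap ℝ B s) := fun s hs => by
    by_contra h
    exact absurd (hmax ⟨hm.trans hs.le, h⟩) (not_le.mpr hs)
  set r : ℝ := √(2 * m) with hr
  have hr0 : 0 < r := Real.sqrt_pos.mpr (by positivity)
  have hrr : r * r = 2 * m := Real.mul_self_sqrt (by positivity)
  have hsc : ∀ s : ℝ, IsUnit (star (r⁻¹ • x) * (r⁻¹ • x) + algebraMap ℝ B s) ↔
      IsUnit (c + algebraMap ℝ B (2 * m * s)) := fun s => by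
    have e : c + algebraMap ℝ B (2 * m * s) =
        Units.mk0 (2 * m) (by positivity) • (star (r⁻¹ • x) * (r⁻¹ • x) + algebraMap ℝ B s) := by
      rw [Units.smul_mk0, star_smul, smul_mul_smul_comm, smul_add, smul_smul, star_trivial,
        ← mul_inv, hrr, mul_inv_cancel₀ (by positivity), one_smul, Algebra.algebraMap_eq_smul_one,
        Algebra.algebraMap_eq_smul_one, smul_smul]
    rw [e, isUnit_smul_iff]
  refine hmn ?_
  have := hB.isUnit_star_mul_self_add_half (r⁻¹ • x) fun s hs => (hsc s).mpr (hunit _ (by nlinarith))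
  rw [hsc] at this
  convert this using 3
  ring

end

end Cone

/-! ### The Gelfand–Naimark–Segal construction for a unital Banach `*`-algebra -/

section GNS

open UniformSpace Completion

open scoped InnerProductSpace

variable {B : Type u} [NormedRing B] [NormedAlgebra ℂ B] [StarRing B]

variable (B) in
/-- A positive functional on a `*`-algebra. -/
structure PosFunctional where
  toLin : B →ₗ[ℂ] ℂ
  map_star : ∀ x, toLin (star x) = star (toLin x)
  re_nonneg : ∀ x, 0 ≤ (toLin (star x * x)).re

namespace PosFunctional

variable (φ : PosFunctional B)

/-- The algebra with the semi-inner product defined by a positive functional. -/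
@[nolint unusedArguments]
def PreGNS (_φ : PosFunctional B) := B

instance : AddCommGroup φ.PreGNS := inferInstanceAs (AddCommGroup B)
instance : Module ℂ φ.PreGNS := inferInstanceAs (Module ℂ B)

/-- The identity map from the algebra to its semi-inner product space. -/
def toPreGNS : B ≃ₗ[ℂ] φ.PreGNS := LinearEquiv.refl ℂ _

variable [StarModule ℂ B]

/-- The semi-inner product `⟪a, b⟫ = φ (a⋆ b)`. -/
abbrev preGNSCore : PreInnerProductSpace.Core ℂ φ.PreGNS where
  inner a b := φ.toLin (star (φ.toPreGNS.symm a) * φ.toPreGNS.symm b)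
  conj_inner_symm a b := by
    rw [← Complex.star_def, ← φ.map_star, star_mul, star_star]
  re_inner_nonneg a := φ.re_nonneg _
  add_left _ _ _ := by rw [map_add, star_add, add_mul, map_add]
  smul_left _ _ _ := by
    rw [map_smul, star_smul, smul_mul_assoc, map_smul, smul_eq_mul]
    rfl

instance : SeminormedAddCommGroup φ.PreGNS :=
  InnerProductSpace.Core.toSeminormedAddCommGroup (c := φ.preGNSCore)
instance : InnerProductSpace ℂ φ.PreGNS := InnerProductSpace.ofCore φ.preGNSCore

theorem inner_toPreGNS (a b : B) : ⟪φ.toPreGNS a, φ.toPreGNS b⟫_ℂ = φ.toLin (star a * b) := rfl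

theorem norm_toPreGNS_sq (a : B) : ‖φ.toPreGNS a‖ ^ 2 = (φ.toLin (star a * a)).re := by
  rw [← inner_toPreGNS, ← inner_self_eq_norm_sq (𝕜 := ℂ)]
  rfl

variable [CompleteSpace B] [ContinuousStar B]

/-- With `v² = 1 - x⋆ x / C`, positivity at `v y` is the claim. No continuity of the functional is
needed; the summand `1` in `C` gives the strict inequality required by the square root lemma. -/
theorem re_conj_le (x y : B) : (φ.toLin (star (x * y) * (x * y))).re ≤
    (‖star x * x‖ + 1) * (φ.toLin (star y * y)).re := by
  set C : ℝ := ‖star x * x‖ + 1 with hC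
  have hC0 : 0 < C := by positivity
  have hsa : IsSelfAdjoint (C⁻¹ • (star x * x)) :=
    IsSelfAdjoint.smul (by simp [IsSelfAdjoint]) (IsSelfAdjoint.star_mul_self x)
  have hr : spectralRadius ℂ (C⁻¹ • (star x * x)) < 1 := by
    have h1 := spectralRadius_pow_le_of_norm_pow_le (a := C⁻¹ • (star x * x)) one_ne_zero
      (norm_nonneg _) (by rw [pow_one, pow_one])
    refine h1.trans_lt ?_
    rw [← ENNReal.ofReal_one, ENNReal.ofReal_lt_ofReal_iff one_pos, norm_smul, norm_inv,
      Real.norm_of_nonneg hC0.le, inv_mul_lt_one₀ hC0, hC]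
    exact lt_add_one _
  obtain ⟨v, hv, hvv⟩ := exists_isSelfAdjoint_mul_self_eq hsa hr
  have h2 := φ.re_nonneg (v * y)
  have e : star (v * y) * (v * y) =
      star y * y - ((C⁻¹ : ℝ) : ℂ) • (star (x * y) * (x * y)) := by
    have : star (v * y) * (v * y) = star y * (v * v) * y := by
      rw [star_mul, hv.star_eq]; noncomm_ring
    rw [this, hvv, mul_sub, sub_mul, mul_one, mul_smul_comm, smul_mul_assoc, star_mul,
      Complex.coe_smul]
    simp only [mul_assoc]
  rw [e, map_sub, map_smul, Complex.sub_re, smul_eq_mul, Complex.re_ofReal_mul, sub_nonneg,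
    inv_mul_le_iff₀ hC0] at h2
  exact h2

/-- The Hilbert space of a positive functional. -/
abbrev GNS := UniformSpace.Completion φ.PreGNS

/-- Left multiplication as an operator on the semi-inner product space. -/
def leftMul (a : B) : φ.PreGNS →L[ℂ] φ.PreGNS :=
  (φ.toPreGNS.toLinearMap ∘ₗ LinearMap.mulLeft ℂ a ∘ₗ φ.toPreGNS.symm.toLinearMap).mkContinuous
    √(‖star a * a‖ + 1) fun x => by
      obtain ⟨y, rfl⟩ := φ.toPreGNS.surjective x
      rw [← Real.sqrt_sq (norm_nonneg (φ.toPreGNS y)), ← Real.sqrt_mul (by positivity)]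
      refine Real.le_sqrt_of_sq_le ?_
      rw [norm_toPreGNS_sq]
      exact (φ.norm_toPreGNS_sq (a * y)).trans_le (φ.re_conj_le a y)

@[simp]
theorem leftMul_toPreGNS (a b : B) : φ.leftMul a (φ.toPreGNS b) = φ.toPreGNS (a * b) := rfl

omit [CompleteSpace B] [ContinuousStar B] in
theorem denseRange_coe_toPreGNS : DenseRange fun b : B => (φ.toPreGNS b : φ.GNS) :=
  (denseRange_coe (α := φ.PreGNS)).comp φ.toPreGNS.surjective.denseRange (continuous_coe _)

variable {φ} in
omit [CompleteSpace B] [ContinuousStar B] in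
theorem gns_ext {S T : φ.GNS →L[ℂ] φ.GNS}
    (h : ∀ b, S (φ.toPreGNS b : φ.GNS) = T (φ.toPreGNS b : φ.GNS)) : S = T :=
  DFunLike.coe_injective
    (φ.denseRange_coe_toPreGNS.equalizer S.continuous T.continuous (funext h))

theorem completion_leftMul_coe (a b : B) :
    (φ.leftMul a).completion (φ.toPreGNS b : φ.GNS) = (φ.toPreGNS (a * b) : φ.GNS) := by
  rw [ContinuousLinearMap.completion_apply_coe, leftMul_toPreGNS]

/-- The Gelfand–Naimark–Segal representation. -/
def gnsRep : B →⋆ₙₐ[ℂ] (φ.GNS →L[ℂ] φ.GNS) where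
  toFun a := (φ.leftMul a).completion
  map_smul' c a := gns_ext fun b => by
    rw [_root_.smul_apply, completion_leftMul_coe, completion_leftMul_coe,
      ← Completion.coe_smul, ← map_smul, smul_mul_assoc]
    rfl
  map_zero' := gns_ext fun b => by
    rw [_root_.zero_apply, completion_leftMul_coe, zero_mul, map_zero,
      Completion.coe_zero]
  map_add' a b := gns_ext fun y => by
    rw [_root_.add_apply, completion_leftMul_coe, completion_leftMul_coe,
      completion_leftMul_coe, ← Completion.coe_add, ← map_add, add_mul]
  map_mul' a b := gns_ext fun y => by
    rw [ContinuousLinearMap.mul_def, ContinuousLinearMap.comp_apply, completion_leftMul_coe, completion_leftMul_coe,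
      completion_leftMul_coe, mul_assoc]
  map_star' a := by
    refine (ContinuousLinearMap.eq_adjoint_iff (φ.leftMul (star a)).completion
      (φ.leftMul a).completion).mpr ?_
    intro x y
    induction x, y using induction_on₂ with
    | hp => apply isClosed_eq <;> fun_prop
    | ih x y =>
      obtain ⟨x, rfl⟩ := φ.toPreGNS.surjective x
      obtain ⟨y, rfl⟩ := φ.toPreGNS.surjective y
      simp [mul_assoc, inner_toPreGNS]

theorem gnsRep_coe (a b : B) :
    φ.gnsRep a (φ.toPreGNS b : φ.GNS) = (φ.toPreGNS (a * b) : φ.GNS) :=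
  φ.completion_leftMul_coe a b

/-- The representation of a positive functional. -/
def starRep : StarRep B where
  H := φ.GNS
  π := φ.gnsRep

/-- The cyclic vector of the Gelfand–Naimark–Segal representation. -/
def cyclicVector : φ.GNS := (φ.toPreGNS 1 : φ.GNS)

theorem gnsRep_cyclicVector (a : B) : φ.gnsRep a φ.cyclicVector = (φ.toPreGNS a : φ.GNS) := by
  rw [cyclicVector, gnsRep_coe, mul_one]

theorem dense_gnsRep_cyclicVector : DenseRange fun a : B => φ.gnsRep a φ.cyclicVector := by
  simp only [gnsRep_cyclicVector]
  exact φ.denseRange_coe_toPreGNS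

theorem inner_cyclicVector (a : B) : ⟪φ.cyclicVector, φ.gnsRep a φ.cyclicVector⟫_ℂ = φ.toLin a := by
  rw [gnsRep_cyclicVector, cyclicVector, Completion.inner_coe, inner_toPreGNS, star_one, one_mul]

theorem norm_gnsRep_cyclicVector_sq (a : B) :
    ‖φ.gnsRep a φ.cyclicVector‖ ^ 2 = (φ.toLin (star a * a)).re := by
  rw [gnsRep_cyclicVector, Completion.norm_coe, norm_toPreGNS_sq]

end PosFunctional

end GNS

/-! ### States vanishing on a left ideal -/

section LeftStates

variable {B : Type u} [NormedRing B] [NormedAlgebra ℂ B] [StarRing B]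

/-- The real part of a state of `B` that vanishes on the left ideal `L`. -/
structure IsLeftState (L : Ideal B) (F : B → ℝ) : Prop where
  map_add : ∀ x y, F (x + y) = F x + F y
  map_smul : ∀ (c : ℝ) x, F (c • x) = c * F x
  map_star : ∀ x, F (star x) = F x
  nonneg : ∀ x, 0 ≤ F (star x * x)
  map_one : F 1 = 1
  eq_zero : ∀ x ∈ L, F (star x * x) = 0

theorem isClosed_setOf_isLeftState (L : Ideal B) : IsClosed {F : B → ℝ | IsLeftState L F} := by
  have e : {F : B → ℝ | IsLeftState L F} =
      {F | ∀ x y, F (x + y) = F x + F y} ∩ {F | ∀ (c : ℝ) x, F (c • x) = c * F x} ∩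
      {F | ∀ x, F (star x) = F x} ∩ {F | ∀ x, 0 ≤ F (star x * x)} ∩ {F | F 1 = 1} ∩
      {F | ∀ x ∈ L, F (star x * x) = 0} := by
    ext F
    constructor
    · rintro ⟨h1, h2, h3, h4, h5, h6⟩
      exact ⟨⟨⟨⟨⟨h1, h2⟩, h3⟩, h4⟩, h5⟩, h6⟩
    · rintro ⟨⟨⟨⟨⟨h1, h2⟩, h3⟩, h4⟩, h5⟩, h6⟩
      exact ⟨h1, h2, h3, h4, h5, h6⟩
  rw [e]
  simp only [Set.ofPred_forall]
  refine ((((IsClosed.inter ?_ ?_).inter ?_).inter ?_).inter ?_).inter ?_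
  · exact isClosed_iInter fun x => isClosed_iInter fun y => isClosed_eq (by fun_prop) (by fun_prop)
  · exact isClosed_iInter fun x => isClosed_iInter fun y => isClosed_eq (by fun_prop) (by fun_prop)
  · exact isClosed_iInter fun x => isClosed_eq (by fun_prop) (by fun_prop)
  · exact isClosed_iInter fun x => isClosed_le (by fun_prop) (by fun_prop)
  · exact isClosed_eq (by fun_prop) (by fun_prop)
  · exact isClosed_iInter fun x => isClosed_iInter fun _ => isClosed_eq (by fun_prop) (by fun_prop)

namespace IsLeftState

variable {L : Ideal B} {F : B → ℝ} (hF : IsLeftState L F)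

include hF

theorem map_neg (x : B) : F (-x) = -F x := by
  have := hF.map_smul (-1) x
  rwa [neg_one_smul, neg_one_mul] at this

theorem map_sub (x y : B) : F (x - y) = F x - F y := by
  rw [sub_eq_add_neg, hF.map_add, hF.map_neg, sub_eq_add_neg]

variable [StarModule ℂ B]

theorem map_I_smul_star (x : B) : F (Complex.I • star x) = -F (Complex.I • x) := by
  rw [← hF.map_star (Complex.I • x), star_smul, ← hF.map_neg]
  congr 1
  simp

/-- The positive functional with real part `F`. -/
def posFunctional : PosFunctional B where
  toLin :=
    { toFun := fun x => ⟨F x, -F (Complex.I • x)⟩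
      map_add' := fun x y => by
        apply Complex.ext
        · simp [hF.map_add]
        · simp [hF.map_add]; ring
      map_smul' := fun c x => by
        have e1 : c • x = c.re • x + c.im • (Complex.I • x) := by
          rw [← Complex.coe_smul, ← Complex.coe_smul, smul_smul, ← add_smul, Complex.re_add_im]
        have e2 : Complex.I • (c • x) = c.re • (Complex.I • x) - c.im • x := by
          rw [e1, smul_add, smul_comm Complex.I c.re, smul_comm Complex.I c.im, smul_smul,
            Complex.I_mul_I]
          module
        apply Complex.ext
        · simp [e1, hF.map_add, hF.map_smul]
        · simp [e2, hF.map_sub, hF.map_smul]; ring }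
  map_star x := by
    apply Complex.ext
    · simp [hF.map_star]
    · simp [hF.map_I_smul_star]
  re_nonneg x := hF.nonneg x

variable [CompleteSpace B] [ContinuousStar B]

/-- For `M > ‖k‖` the element `1 - k/M` is the square of a self-adjoint element, so a state is
nonnegative on it. Continuity is thus automatic, and the set of states is pointwise bounded. -/
theorem le_norm {k : B} (hk : IsSelfAdjoint k) : F k ≤ ‖k‖ := by
  refine le_of_forall_gt_imp_ge_of_dense fun M hM => ?_
  have hM0 : 0 < M := (norm_nonneg k).trans_lt hM
  have hr : spectralRadius ℂ (M⁻¹ • k) < 1 := by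
    have h1 := spectralRadius_pow_le_of_norm_pow_le (a := M⁻¹ • k) one_ne_zero
      (norm_nonneg _) (by rw [pow_one, pow_one])
    refine h1.trans_lt ?_
    rwa [← ENNReal.ofReal_one, ENNReal.ofReal_lt_ofReal_iff one_pos, norm_smul, norm_inv,
      Real.norm_of_nonneg hM0.le, inv_mul_lt_one₀ hM0]
  obtain ⟨v, hv, hvv⟩ := exists_isSelfAdjoint_mul_self_eq
    (IsSelfAdjoint.smul (r := M⁻¹) (by simp [IsSelfAdjoint]) hk) hr
  have h2 := hF.nonneg v
  rw [hv.star_eq, hvv, hF.map_sub, hF.map_one, hF.map_smul, sub_nonneg, inv_mul_le_iff₀ hM0,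
    mul_one] at h2
  exact h2

theorem abs_le_norm (x : B) : |F x| ≤ ‖x + star x‖ := by
  have hs : IsSelfAdjoint (x + star x) := IsSelfAdjoint.add_star_self x
  have h1 := hF.le_norm hs
  have h2 := hF.le_norm hs.neg
  rw [hF.map_add, hF.map_star] at h1
  rw [hF.map_neg, norm_neg, hF.map_add, hF.map_star] at h2
  have := norm_nonneg (x + star x)
  exact abs_le.mpr ⟨by linarith, by linarith⟩

end IsLeftState

variable [StarModule ℂ B] [CompleteSpace B] [ContinuousStar B]

theorem isCompact_setOf_isLeftState (L : Ideal B) : IsCompact {F : B → ℝ | IsLeftState L F} := by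
  refine (isCompact_univ_pi fun x : B => isCompact_Icc (a := -‖x + star x‖) (b := ‖x + star x‖)).of_isClosed_subset
    (isClosed_setOf_isLeftState L) fun F hF x _ => abs_le.mp (IsLeftState.abs_le_norm hF x)

theorem UnitalHermitian.exists_isLeftState (hB : UnitalHermitian B) {L : Ideal B} (hL : L ≠ ⊤) :
    ∃ F, IsLeftState L F := by
  -- `O` consists of the elements whose self-adjoint part is strictly positive, `T` is the
  -- self-adjoint part of `L`. A common element would be a unit in the proper ideal `L`.
  let O : Set B := {x | ∃ δ : ℝ, 0 < δ ∧ SpectrallyNonneg (x + star x - algebraMap ℝ B δ)}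
  let T : Set B := {x | x ∈ L ∧ IsSelfAdjoint x}
  have hO_smul : ∀ c : ℝ, 0 < c → ∀ x ∈ O, c • x ∈ O := by
    rintro c hc x ⟨δ, hδ, h⟩
    refine ⟨c * δ, by positivity, ?_⟩
    convert h.smul hc using 1
    rw [smul_sub, smul_add, star_smul, star_trivial, Algebra.algebraMap_eq_smul_one,
      Algebra.algebraMap_eq_smul_one, smul_smul]
  have hO_conv : Convex ℝ O := by
    refine convex_iff_forall_pos.mpr fun x hx y hy a b ha hb _ => ?_
    obtain ⟨δ, hδ, h⟩ := hO_smul a ha x hx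
    obtain ⟨ε, hε, h'⟩ := hO_smul b hb y hy
    refine ⟨δ + ε, by positivity, ?_⟩
    convert h.add hB h' using 1
    rw [star_add, map_add]; abel
  have hO_open : IsOpen O := by
    refine isOpen_iff_mem_nhds.mpr ?_
    rintro x ⟨δ, hδ, h⟩
    have hc : Continuous fun y : B => ‖(y - x) + star (y - x)‖ := by fun_prop
    have h0 : ‖(x - x) + star (x - x)‖ < δ / 2 := by simpa using hδ
    filter_upwards [hc.continuousAt.eventually_lt continuousAt_const h0] with y hy
    refine ⟨δ / 2, by positivity, ?_⟩
    convert h.add hB (spectrallyNonneg_add_algebraMap_of_norm_le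
      (IsSelfAdjoint.add_star_self (y - x)) hy.le) using 1
    have : algebraMap ℝ B δ = algebraMap ℝ B (δ / 2) + algebraMap ℝ B (δ / 2) := by
      rw [← _root_.map_add, add_halves]
    rw [this, star_sub]; abel
  have hT_conv : Convex ℝ T := by
    intro x hx y hy a b _ _ _
    refine ⟨L.add_mem ?_ ?_, ?_⟩
    · rw [← Complex.coe_smul, Algebra.smul_def]; exact L.mul_mem_left _ hx.1
    · rw [← Complex.coe_smul, Algebra.smul_def]; exact L.mul_mem_left _ hy.1
    · exact (IsSelfAdjoint.smul (by simp [IsSelfAdjoint]) hx.2).add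
        (IsSelfAdjoint.smul (by simp [IsSelfAdjoint]) hy.2)
  have hdisj : Disjoint O T := by
    refine Set.disjoint_left.mpr ?_
    rintro x ⟨δ, hδ, h⟩ ⟨hxL, hxs⟩
    have h1 := h.2 δ hδ
    rw [sub_add_cancel, hxs.star_eq] at h1
    exact hL (Ideal.eq_top_of_isUnit_mem _ (L.add_mem hxL hxL) h1)
  obtain ⟨f, c, hfO, hfT⟩ := geometric_hahn_banach_open hO_conv hO_open hT_conv hdisj
  have h0T : (0 : B) ∈ T := ⟨L.zero_mem, IsSelfAdjoint.zero B⟩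
  have hc0 : c ≤ 0 := by simpa using hfT 0 h0T
  have hfT0 : ∀ x ∈ T, f x = 0 := by
    intro x hx
    by_contra hne
    have hmem : ((c - 1) / f x) • x ∈ T := by
      refine ⟨?_, IsSelfAdjoint.smul (by simp [IsSelfAdjoint]) hx.2⟩
      rw [← Complex.coe_smul, Algebra.smul_def]; exact L.mul_mem_left _ hx.1
    have := hfT _ hmem
    rw [_root_.map_smul, smul_eq_mul, div_mul_cancel₀ _ hne] at this
    linarith
  have h1O : (1 : B) ∈ O := by
    refine ⟨1, one_pos, ?_⟩
    have := hB.spectrallyNonneg_mul_self (IsSelfAdjoint.one B)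
    simpa using this
  have hf1 : f 1 < 0 := (hfO 1 h1O).trans_le hc0
  -- A small positive multiple of `1` pushes `h` into `O`; then let it tend to `0`.
  have hnn : ∀ h, SpectrallyNonneg h → f h ≤ 0 := by
    intro h hh
    refine le_of_forall_pos_le_add fun ε hε => ?_
    have hmem : h + (ε / (-f 1)) • (1 : B) ∈ O := by
      have hs : 0 < ε / (-f 1) := div_pos hε (by linarith)
      refine ⟨ε / (-f 1), hs, ?_⟩
      convert (hh.add hB hh).add_algebraMap hs.le using 1
      rw [star_add, hh.1.star_eq, star_smul, star_one, star_trivial,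
        Algebra.algebraMap_eq_smul_one]
      abel
    have := (hfO _ hmem).trans_le hc0
    rw [_root_.map_add, _root_.map_smul, smul_eq_mul, div_mul_eq_mul_div, div_neg,
      mul_div_cancel_right₀ _ hf1.ne] at this
    linarith
  -- Symmetrize and normalize; dividing by `f 1 < 0` reverses the sign. Nonnegativity on `x⋆ x` is
  -- the Shirali–Ford theorem.
  refine ⟨fun x => f (x + star x) / (2 * f 1), ?_, ?_, ?_, ?_, ?_, ?_⟩
  · intro x y
    rw [← add_div, ← _root_.map_add, star_add]
    congr 2; abel
  · intro a x
    rw [star_smul, star_trivial, ← smul_add, _root_.map_smul, smul_eq_mul, mul_div_assoc]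
  · intro x
    rw [star_star, add_comm]
  · intro x
    have := hnn _ (hB.spectrallyNonneg_star_mul_self x)
    rw [star_mul, star_star, _root_.map_add]
    exact div_nonneg_of_nonpos (by linarith) (by linarith)
  · rw [star_one, _root_.map_add, ← two_mul, div_self (by linarith)]
  · intro x hx
    have := hfT0 (star x * x) ⟨L.mul_mem_left _ hx, IsSelfAdjoint.star_mul_self x⟩
    rw [star_mul, star_star, _root_.map_add, this, add_zero, zero_div]

/-- An extreme point among the states vanishing on `L`. -/
theorem UnitalHermitian.exists_mem_extremePoints (hB : UnitalHermitian B) {L : Ideal B}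
    (hL : L ≠ ⊤) : ∃ F, F ∈ Set.extremePoints ℝ {F : B → ℝ | IsLeftState L F} :=
  (isCompact_setOf_isLeftState L).extremePoints_nonempty (hB.exists_isLeftState hL)

end LeftStates

/-! ### The representation of an extreme state is irreducible -/

section Irreducible

open scoped InnerProductSpace

variable {B : Type u} [NormedRing B] [NormedAlgebra ℂ B] [StarRing B]

/-- A vector annihilated by `L` defines a multiple of a state vanishing on `L`. -/
theorem isLeftState_of_vector (ρ : StarRep B) (hone : ρ.π 1 = 1) {L : Ideal B} {η : ρ.H}
    (hη : η ≠ 0) (hL : ∀ x ∈ L, ρ.π x η = 0) :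
    IsLeftState L fun x => (⟪η, ρ.π x η⟫_ℂ).re / ‖η‖ ^ 2 := by
  have hη2 : ‖η‖ ^ 2 ≠ 0 := by positivity
  have hsq : ∀ x, ⟪η, ρ.π (star x * x) η⟫_ℂ = (‖ρ.π x η‖ ^ 2 : ℝ) := fun x => by
    rw [map_mul, map_star, ContinuousLinearMap.mul_def, ContinuousLinearMap.comp_apply,
      ContinuousLinearMap.star_eq_adjoint, ContinuousLinearMap.adjoint_inner_right,
      inner_self_eq_norm_sq_to_K]
    norm_cast
  refine ⟨fun x y => ?_, fun c x => ?_, fun x => ?_, fun x => ?_, ?_, fun x hx => ?_⟩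
  · rw [map_add, _root_.add_apply, inner_add_right, Complex.add_re, add_div]
  · rw [← Complex.coe_smul, map_smul, _root_.smul_apply, inner_smul_right, Complex.re_ofReal_mul,
      mul_div_assoc]
  · rw [map_star, ContinuousLinearMap.star_eq_adjoint, ContinuousLinearMap.adjoint_inner_right,
      ← inner_conj_symm, Complex.conj_re]
  · rw [hsq, Complex.ofReal_re]; positivity
  · rw [hone, one_apply_eq_self, show (⟪η, η⟫_ℂ).re = ‖η‖ ^ 2 from inner_self_eq_norm_sq (𝕜 := ℂ) η,
      div_self hη2]
  · rw [hsq, hL x hx]; simp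

/-- The orthogonal projection onto an invariant subspace commutes with the representation. -/
theorem StarRep.apply_starProjection (ρ : StarRep B) {K : Submodule ℂ ρ.H}
    [K.HasOrthogonalProjection] (hK : ∀ a, ∀ x ∈ K, ρ.π a x ∈ K) (a : B) (v : ρ.H) :
    ρ.π a (K.starProjection v) = K.starProjection (ρ.π a v) := by
  refine (Submodule.eq_starProjection_of_mem_of_inner_eq_zero (hK a _ (K.starProjection_apply_mem v)) ?_).symm
  intro w hw
  rw [← map_sub, ← ContinuousLinearMap.adjoint_inner_right, ← ContinuousLinearMap.star_eq_adjoint,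
    ← map_star]
  exact K.starProjection_inner_eq_zero v _ (hK _ _ hw)

/-- A cyclic representation is irreducible if its cyclic vector gives an extreme state among those
vanishing on a left ideal. -/
theorem StarRep.isTopIrreducible_of_mem_extremePoints (ρ : StarRep B) (hone : ρ.π 1 = 1) {ξ : ρ.H}
    (hξ : DenseRange fun a : B => ρ.π a ξ) {L : Ideal B}
    (hF : (fun x => (⟪ξ, ρ.π x ξ⟫_ℂ).re) ∈ Set.extremePoints ℝ {F : B → ℝ | IsLeftState L F}) :
    ρ.IsTopIrreducible := by
  have hF1 : IsLeftState L fun x => (⟪ξ, ρ.π x ξ⟫_ℂ).re := hF.1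
  have hself : ∀ v : ρ.H, (⟪v, v⟫_ℂ).re = ‖v‖ ^ 2 := fun v => inner_self_eq_norm_sq (𝕜 := ℂ) v
  have hstar : ∀ x (v w : ρ.H), ⟪v, ρ.π x w⟫_ℂ = ⟪ρ.π (star x) v, w⟫_ℂ := fun x v w => by
    rw [map_star, ContinuousLinearMap.star_eq_adjoint, ContinuousLinearMap.adjoint_inner_left]
  have hLξ : ∀ x ∈ L, ρ.π x ξ = 0 := fun x hx => by
    have h := hF1.eq_zero x hx
    rw [map_mul, ContinuousLinearMap.mul_def, ContinuousLinearMap.comp_apply, hstar, star_star,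
      hself] at h
    simpa using h
  have hξ1 : ‖ξ‖ ^ 2 = 1 := by
    have h := hF1.map_one
    rwa [hone, one_apply_eq_self, hself] at h
  have hdense : ∀ w : ρ.H, (∀ x, (⟪w, ρ.π x ξ⟫_ℂ).re = 0) → w = 0 := fun w hw => by
    have hcl : IsClosed {v : ρ.H | (⟪w, v⟫_ℂ).re = 0} :=
      isClosed_eq (by fun_prop) continuous_const
    have h2 : (⟪w, w⟫_ℂ).re = 0 :=
      closure_minimal (by rintro _ ⟨x, rfl⟩; exact hw x) hcl (hξ w)
    rw [hself] at h2
    simpa using h2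
  refine ⟨fun h0 => ?_, fun K hKc hK => ?_⟩
  · have : ρ.π 1 ξ = 0 := by rw [h0]; rfl
    rw [hone, one_apply_eq_self] at this
    rw [this] at hξ1
    simp at hξ1
  have hξK : ∀ K' : Submodule ℂ ρ.H, IsClosed (K' : Set ρ.H) →
      (∀ a, ∀ x ∈ K', ρ.π a x ∈ K') → ξ ∈ K' → K' = ⊤ := by
    intro K' hc hinv hmem
    refine eq_top_iff.mpr fun v _ => ?_
    exact closure_minimal (by rintro _ ⟨x, rfl⟩; exact hinv x _ hmem) hc (hξ v)
  have : CompleteSpace K := hKc.completeSpace_coe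
  have hcomm := fun a v => ρ.apply_starProjection hK a v
  -- If neither `p` nor `ξ - p` vanishes, the state is a convex combination of the normalized vector
  -- states of both, with weights `‖p‖²` and `‖ξ - p‖²`. These vanish on `L` because the projection
  -- commutes with the representation.
  set p : ρ.H := K.starProjection ξ with hp
  have hpK : p ∈ K := K.starProjection_apply_mem ξ
  by_cases hp0 : p = 0
  · left
    have hmem : ξ ∈ Kᗮ := by
      have := K.sub_starProjection_mem_orthogonal ξ
      rwa [← hp, hp0, sub_zero] at this
    have htop := hξK Kᗮ K.isClosed_orthogonal (fun a x hx => by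
      have hx0 : K.starProjection x = 0 := (Submodule.starProjection_apply_eq_zero_iff K).mpr hx
      refine (Submodule.starProjection_apply_eq_zero_iff K).mp ?_
      rw [← hcomm, hx0, map_zero]) hmem
    exact (Submodule.orthogonal_eq_top_iff K).mp htop
  right
  by_cases hq0 : ξ - p = 0
  · exact hξK K hKc hK (by rw [sub_eq_zero.mp hq0]; exact hpK)
  have hpL : ∀ x ∈ L, ρ.π x p = 0 := fun x hx => by rw [hp, hcomm, hLξ x hx, map_zero]
  have hqL : ∀ x ∈ L, ρ.π x (ξ - p) = 0 := fun x hx => by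
    rw [map_sub, hpL x hx, hLξ x hx, sub_zero]
  have horth : ∀ v ∈ K, ⟪v, ξ - p⟫_ℂ = 0 := fun v hv =>
    K.sub_starProjection_mem_orthogonal ξ v hv
  have horth2 : ∀ x, ⟪p, ρ.π x (ξ - p)⟫_ℂ = 0 := fun x => by
    rw [hstar]; exact horth _ (hK _ p hpK)
  have hsplit : ∀ x, (⟪ξ, ρ.π x ξ⟫_ℂ).re =
      (⟪p, ρ.π x p⟫_ℂ).re + (⟪ξ - p, ρ.π x (ξ - p)⟫_ℂ).re := fun x => by
    have h1 : ⟪ξ - p, ρ.π x p⟫_ℂ = 0 := by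
      rw [← inner_conj_symm, horth _ (hK x p hpK), map_zero]
    have e : ⟪ξ, ρ.π x ξ⟫_ℂ = ⟪p + (ξ - p), ρ.π x (p + (ξ - p))⟫_ℂ := by
      rw [add_sub_cancel]
    rw [e, map_add, inner_add_left, inner_add_right, inner_add_right, h1, horth2, add_zero,
      zero_add, Complex.add_re]
  have hnorm : ‖p‖ ^ 2 + ‖ξ - p‖ ^ 2 = 1 := by
    have := hsplit 1
    rw [hone, one_apply_eq_self, one_apply_eq_self, one_apply_eq_self, hself, hself, hself] at this
    rw [← this, hξ1]
  have hp2 : 0 < ‖p‖ ^ 2 := by positivity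
  have hq2 : 0 < ‖ξ - p‖ ^ 2 := by positivity
  have hext := (mem_extremePoints.mp hF).2 _ (isLeftState_of_vector ρ hone hp0 hpL) _
    (isLeftState_of_vector ρ hone hq0 hqL) ⟨‖p‖ ^ 2, ‖ξ - p‖ ^ 2, hp2, hq2, hnorm, by
      funext x
      simp only [Pi.add_apply, Pi.smul_apply, smul_eq_mul]
      rw [mul_div_cancel₀ _ hp2.ne', mul_div_cancel₀ _ hq2.ne', hsplit]⟩
  -- By extremality the state of `p` is the original one, so `p` and `‖p‖² ξ` have the same inner
  -- products with the dense orbit of `ξ`. Hence `ξ` lies in `K`.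
  have hzero : p - ((‖p‖ ^ 2 : ℝ) : ℂ) • ξ = 0 := by
    refine hdense _ fun x => ?_
    have h2 : ⟪p, ρ.π x p⟫_ℂ = ⟪p, ρ.π x ξ⟫_ℂ := by
      have := horth2 x
      rw [map_sub, inner_sub_right, sub_eq_zero] at this
      exact this.symm
    have h3 : (⟪p, ρ.π x p⟫_ℂ).re / ‖p‖ ^ 2 = (⟪ξ, ρ.π x ξ⟫_ℂ).re := congrFun hext.1 x
    rw [h2, div_eq_iff hp2.ne'] at h3
    rw [inner_sub_left, inner_smul_left, Complex.conj_ofReal, Complex.sub_re,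
      Complex.re_ofReal_mul, h3]
    ring
  refine hξK K hKc hK ?_
  have hmem : ((‖p‖ ^ 2 : ℝ) : ℂ) • ξ ∈ K := by rw [← sub_eq_zero.mp hzero]; exact hpK
  have := K.smul_mem ((‖p‖ ^ 2 : ℝ) : ℂ)⁻¹ hmem
  rwa [smul_smul, inv_mul_cancel₀ (by exact_mod_cast hp2.ne'), one_smul] at this

variable [StarModule ℂ B] [CompleteSpace B] [ContinuousStar B]

/-- For a maximal left ideal `L` of a hermitian Banach `*`-algebra `B`, some topologically irreducible
`*`-representation has the same kernel as the module `B / L`. -/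
theorem UnitalHermitian.exists_starRep (hB : UnitalHermitian B) {L : Ideal B} (hL : L.IsMaximal) :
    ∃ ρ : StarRep B, ρ.IsTopIrreducible ∧ ρ.π 1 = 1 ∧ ∀ x, ρ.π x = 0 ↔ ∀ y, x * y ∈ L := by
  obtain ⟨F, hF⟩ := hB.exists_mem_extremePoints hL.ne_top
  have hF1 : IsLeftState L F := hF.1
  set φ := hF1.posFunctional
  have hone : φ.gnsRep 1 = 1 := PosFunctional.gns_ext fun b => by
    rw [PosFunctional.gnsRep_coe, one_mul, one_apply_eq_self]
  -- The left kernel of the state contains `L` and is proper since the state is `1` at `1`, so it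
  -- equals `L` by maximality.
  let N : Ideal B :=
    { carrier := {x | φ.gnsRep x φ.cyclicVector = 0}
      add_mem' := fun {x y} hx hy => by
        change φ.gnsRep (x + y) _ = 0
        rw [map_add, _root_.add_apply, show φ.gnsRep x _ = 0 from hx,
          show φ.gnsRep y _ = 0 from hy, add_zero]
      zero_mem' := by
        change φ.gnsRep 0 _ = 0
        rw [map_zero, _root_.zero_apply]
      smul_mem' := fun c x hx => by
        change φ.gnsRep (c * x) _ = 0
        rw [map_mul, ContinuousLinearMap.mul_def, ContinuousLinearMap.comp_apply,
          show φ.gnsRep x _ = 0 from hx, map_zero] }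
  have hmem : ∀ x, x ∈ N ↔ F (star x * x) = 0 := fun x => by
    change φ.gnsRep x φ.cyclicVector = 0 ↔ _
    rw [← norm_eq_zero, ← sq_eq_zero_iff, PosFunctional.norm_gnsRep_cyclicVector_sq]
    rfl
  have hLN : L = N := hL.eq_of_le (fun h => by
    have h1 : (1 : B) ∈ N := by rw [h]; trivial
    rw [hmem, star_one, mul_one, hF1.map_one] at h1
    exact one_ne_zero h1) fun x hx => (hmem x).mpr (hF1.eq_zero x hx)
  have hFφ : (fun x => (⟪φ.cyclicVector, φ.gnsRep x φ.cyclicVector⟫_ℂ).re) = F := by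
    funext x
    rw [PosFunctional.inner_cyclicVector]
    rfl
  refine ⟨φ.starRep, φ.starRep.isTopIrreducible_of_mem_extremePoints hone
    φ.dense_gnsRep_cyclicVector (L := L) (hFφ.symm ▸ hF), hone, fun x => ⟨fun h y => ?_, fun h => ?_⟩⟩
  · rw [hLN]
    change φ.gnsRep (x * y) _ = 0
    have h' : φ.gnsRep x = 0 := h
    rw [map_mul, h', zero_mul, _root_.zero_apply]
  · refine PosFunctional.gns_ext fun b => ?_
    have := h b
    rw [hLN] at this
    have h' : φ.gnsRep (x * b) φ.cyclicVector = 0 := this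
    rw [PosFunctional.gnsRep_cyclicVector] at h'
    exact (φ.gnsRep_coe x b).trans h'

end Irreducible

/-! ### Primitive ideals of a hermitian algebra are kernels of irreducible `*`-representations -/

section PrimLe

variable {A : Type u} [NonUnitalNormedRing A] [NormedSpace ℂ A]

/-- An irreducible module is generated by each of its non-zero vectors. -/
theorem IsAlgIrreducible.exists_apply_eq {X : Type u} [AddCommGroup X] [Module ℂ X]
    {π : A →ₙₐ[ℂ] Module.End ℂ X} (hπ : IsAlgIrreducible π) {v : X} (hv : v ≠ 0) (w : X) :
    ∃ a, π a v = w := by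
  let K : Submodule ℂ X := LinearMap.range
    ({ toFun := fun a => π a v
       map_add' := fun a b => by rw [map_add, LinearMap.add_apply]
       map_smul' := fun c a => by rw [map_smul, LinearMap.smul_apply]; rfl } : A →ₗ[ℂ] X)
  have hK : ∀ a : A, ∀ x ∈ K, π a x ∈ K := by
    rintro a _ ⟨b, rfl⟩
    exact ⟨a * b, by simp⟩
  rcases hπ.2 K hK with h | h
  · exfalso
    -- The vectors annihilated by all of `A`: an invariant subspace which contains `v ≠ 0`, hence
    -- everything, contradicting `π ≠ 0`.
    let N : Submodule ℂ X :=
      { carrier := {x | ∀ a, π a x = 0}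
        add_mem' := fun hx hy a => by rw [map_add, hx a, hy a, add_zero]
        zero_mem' := fun a => map_zero _
        smul_mem' := fun c x hx a => by rw [map_smul, hx a, smul_zero] }
    have hvN : v ∈ N := fun a => by
      have : π a v ∈ K := ⟨a, rfl⟩
      rwa [h] at this
    rcases hπ.2 N (fun a x hx b => by rw [hx a, map_zero]) with h' | h'
    · rw [h'] at hvN
      exact hv hvN
    · refine hπ.1 (NonUnitalAlgHom.ext fun a => LinearMap.ext fun x => ?_)
      have : x ∈ N := by rw [h']; trivial
      exact this a
  · have : w ∈ K := by rw [h]; trivial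
    exact this

variable [IsScalarTower ℂ A A] [SMulCommClass ℂ A A]

/-- The extension of a representation of `A` to the unitization. -/
def liftL1 {R : Type*} [Ring R] [Algebra ℂ R] (π : A →ₙₐ[ℂ] R) : L1Unitization A →ₐ[ℂ] R :=
  (Unitization.lift π).comp (WithLp.unitizationAlgEquiv ℂ (𝕜 := ℂ) (A := A)).toAlgHom

theorem liftL1_toL1 {R : Type*} [Ring R] [Algebra ℂ R] (π : A →ₙₐ[ℂ] R) (a : A) :
    liftL1 π (toL1 a) = π a := by
  change Unitization.lift π (a : Unitization ℂ A) = π a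
  simp

theorem eq_algebraMap_add_toL1 (x : L1Unitization A) :
    x = algebraMap ℂ _ (WithLp.ofLp x).fst + toL1 (WithLp.ofLp x).snd := by
  apply WithLp.ofLp_injective 1
  change _ = algebraMap ℂ (Unitization ℂ A) (WithLp.ofLp x).fst + ((WithLp.ofLp x).snd : Unitization ℂ A)
  exact (Unitization.inl_fst_add_inr_snd_eq _).symm

theorem isUnit_algebraMap_sub_toL1 {a : A} {z : ℂ} (hz : z ∉ quasispectrum ℂ a) :
    IsUnit (algebraMap ℂ (L1Unitization A) z - toL1 a) := by
  rw [Unitization.quasispectrum_eq_spectrum_inr' ℂ ℂ a, spectrum.notMem_iff] at hz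
  have := hz.map (WithLp.unitizationAlgEquiv ℂ (𝕜 := ℂ) (A := A)).symm
  exact this

variable [StarRing A] [StarModule ℂ A]

theorem IsHermitianAlgebra.unitalHermitian (h : IsHermitianAlgebra A) :
    UnitalHermitian (L1Unitization A) := by
  intro x hx z hz
  have hfst : star (WithLp.ofLp x).fst = (WithLp.ofLp x).fst :=
    congrArg (fun y => (WithLp.ofLp y).fst) hx
  have hsnd : star (WithLp.ofLp x).snd = (WithLp.ofLp x).snd :=
    congrArg (fun y => (WithLp.ofLp y).snd) hx
  have him : (WithLp.ofLp x).fst.im = 0 := Complex.conj_eq_iff_im.mp hfst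
  have h1 : z - (WithLp.ofLp x).fst ∉ quasispectrum ℂ (WithLp.ofLp x).snd := fun hmem => by
    have := h _ hsnd _ hmem
    rw [Complex.sub_im, him, sub_zero] at this
    exact hz this
  have := isUnit_algebraMap_sub_toL1 h1
  rw [map_sub, sub_sub, ← eq_algebraMap_add_toL1] at this
  exact this

/-- The embedding of `A` into its unitization as a `*`-homomorphism. -/
def toL1Hom : A →⋆ₙₐ[ℂ] L1Unitization A where
  toFun := toL1
  map_smul' := toL1_smul
  map_zero' := by simpa using toL1_smul (0 : ℂ) (0 : A)
  map_add' := toL1_add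
  map_mul' := toL1_mul
  map_star' := toL1_star

variable [CompleteSpace A] [ContinuousStar A]

/-- The annihilator in the unitization of a nonzero vector `v` of the module is a maximal left
ideal. The `*`-representation attached to it has, restricted to `A`, the same kernel as the module.
-/
theorem prim_subset_primStar (h : IsHermitianAlgebra A) : Prim A ⊆ PrimStar A := by
  rintro P ⟨X, _, _, π, hπ, hP⟩
  obtain ⟨v, hv⟩ : ∃ v : X, v ≠ 0 := by
    by_contra! hall
    exact hπ.1 (NonUnitalAlgHom.ext fun a => LinearMap.ext fun x => by
      rw [hall (π a x)]; simp)
  let L : Ideal (L1Unitization A) :=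
    { carrier := {x | liftL1 π x v = 0}
      add_mem' := fun {x y} hx hy => by
        change liftL1 π (x + y) v = 0
        rw [map_add, LinearMap.add_apply, show liftL1 π x v = 0 from hx,
          show liftL1 π y v = 0 from hy, add_zero]
      zero_mem' := by
        change liftL1 π 0 v = 0
        rw [map_zero, LinearMap.zero_apply]
      smul_mem' := fun c x hx => by
        change liftL1 π (c * x) v = 0
        rw [map_mul, Module.End.mul_apply, show liftL1 π x v = 0 from hx, map_zero] }
  have hmem : ∀ x, x ∈ L ↔ liftL1 π x v = 0 := fun x => Iff.rfl
  have hL : L.IsMaximal := by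
    refine Ideal.isMaximal_iff.mpr ⟨fun h1 => ?_, fun J x hLJ hx hxJ => ?_⟩
    · rw [hmem, map_one, Module.End.one_apply] at h1
      exact hv h1
    · obtain ⟨a, ha⟩ := hπ.exists_apply_eq (v := liftL1 π x v) hx v
      have h1 : 1 - toL1 a * x ∈ L := by
        rw [hmem, map_sub, map_mul, map_one, LinearMap.sub_apply, Module.End.mul_apply,
          liftL1_toL1, ha, Module.End.one_apply, sub_self]
      have := J.add_mem (hLJ h1) (J.mul_mem_left (toL1 a) hxJ)
      rwa [sub_add_cancel] at this
  obtain ⟨ρ, hρ, hone, hker⟩ := h.unitalHermitian.exists_starRep hL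
  let ρ' : StarRep A := { H := ρ.H, π := ρ.π.comp toL1Hom }
  have hker' : ∀ a, ρ'.π a = 0 ↔ π a = 0 := fun a => by
    change ρ.π (toL1 a) = 0 ↔ _
    rw [hker]
    constructor
    · intro h1
      refine LinearMap.ext fun w => ?_
      obtain ⟨b, rfl⟩ := hπ.exists_apply_eq hv w
      have := h1 (toL1 b)
      rwa [hmem, map_mul, Module.End.mul_apply, liftL1_toL1, liftL1_toL1] at this
    · intro h1 y
      rw [hmem, map_mul, Module.End.mul_apply, liftL1_toL1, h1, LinearMap.zero_apply]
  -- Restriction to `A` preserves irreducibility because the unitization is `ℂ 1 + A` and `1` acts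
  -- as the identity.
  refine ⟨ρ', ⟨fun h0 => hπ.1 ?_, fun K hKc hK => hρ.2 K hKc fun x w hw => ?_⟩, fun a => ?_⟩
  · exact NonUnitalAlgHom.ext fun a => (hker' a).mp (by rw [h0]; rfl)
  · rw [eq_algebraMap_add_toL1 x, map_add, Algebra.algebraMap_eq_smul_one, map_smul, hone]
    exact K.add_mem (K.smul_mem _ hw) (hK _ w hw)
  · rw [hP, hker']

end PrimLe

/-! ### Primitive ideals and left quasi-inverses -/

section QuasiInverse

variable {A : Type u} [NonUnitalNormedRing A] [NormedSpace ℂ A]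

theorem ClosedIdeal.mul_mem_left (I : ClosedIdeal A) (a : A) {x : A} (hx : x ∈ I) : a * x ∈ I :=
  I.mul_mem_left' a hx

theorem ClosedIdeal.mul_mem_right (I : ClosedIdeal A) {x : A} (a : A) (hx : x ∈ I) : x * a ∈ I :=
  I.mul_mem_right' a hx

theorem ClosedIdeal.isClosed (I : ClosedIdeal A) : IsClosed (I : Set A) := I.isClosed'

variable [IsScalarTower ℂ A A] [SMulCommClass ℂ A A]

/-- The equation says `(1 - v)(1 - c) = 1`; the inverse of `1 - c` in the unitization has scalar
part `1`, so it is of the form `1 - v`. -/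
theorem exists_left_quasi_inverse_of_norm_lt_one [CompleteSpace A] {c : A} (hc : ‖c‖ < 1) :
    ∃ v : A, v + c - v * c = 0 := by
  have hu : IsUnit (1 - toL1 c) := isUnit_one_sub_of_norm_lt_one (by rwa [norm_toL1])
  obtain ⟨w, hw⟩ := hu.exists_left_inv
  have hfst : (WithLp.ofLp w).fst = 1 := by
    have := congrArg (fun y => (WithLp.ofLp y).fst) hw
    change (WithLp.ofLp w).fst * (1 - 0) = 1 at this
    simpa using this
  have hw2 : w = 1 + toL1 (WithLp.ofLp w).snd := by
    conv_lhs => rw [eq_algebraMap_add_toL1 w, hfst, map_one]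
  refine ⟨-(WithLp.ofLp w).snd, toL1_injective ?_⟩
  rw [hw2] at hw
  set v := (WithLp.ofLp w).snd
  have h0 : toL1 (0 : A) = 0 := by simpa using toL1_smul (0 : ℂ) (0 : A)
  have hneg : toL1 (-v) = -toL1 v := by simpa using toL1_smul (-1 : ℂ) v
  rw [toL1_sub, toL1_add, toL1_mul, hneg, h0]
  have : (1 + toL1 v) * (1 - toL1 c) = 1 + (toL1 v - toL1 c - toL1 v * toL1 c) := by noncomm_ring
  rw [this, add_eq_left] at hw
  rw [← neg_eq_zero, ← hw]
  noncomm_ring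

/-- The representation on the quotient by a left ideal. -/
def quotientRep (L : Submodule ℂ A) (hL : ∀ a : A, ∀ x ∈ L, a * x ∈ L) :
    A →ₙₐ[ℂ] Module.End ℂ (A ⧸ L) where
  toFun a := L.mapQ L (LinearMap.mulLeft ℂ a) (fun x hx => hL a x hx)
  map_smul' c a := Submodule.linearMap_qext _ <| LinearMap.ext fun x =>
    congrArg L.mkQ (smul_mul_assoc c a x)
  map_zero' := Submodule.linearMap_qext _ <| LinearMap.ext fun x => congrArg L.mkQ (zero_mul x)
  map_add' a b := Submodule.linearMap_qext _ <| LinearMap.ext fun x =>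
    congrArg L.mkQ (add_mul a b x)
  map_mul' a b := Submodule.linearMap_qext _ <| LinearMap.ext fun x =>
    congrArg L.mkQ (mul_assoc a b x)

theorem quotientRep_mk (L : Submodule ℂ A) (hL : ∀ a : A, ∀ x ∈ L, a * x ∈ L) (a x : A) :
    quotientRep L hL a (L.mkQ x) = L.mkQ (a * x) := rfl

/-- If `c` has no left quasi-inverse modulo the two-sided ideal `I`, then it has none modulo some
primitive ideal containing `I`. -/
theorem exists_prim_of_forall_notMem [CompleteSpace A] (I : Submodule ℂ A)
    (hIl : ∀ a : A, ∀ x ∈ I, a * x ∈ I) (hIr : ∀ a : A, ∀ x ∈ I, x * a ∈ I) {c : A}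
    (hc : ∀ y, y + c - y * c ∉ I) :
    ∃ P ∈ Prim A, (∀ x ∈ I, x ∈ P) ∧ ∀ y, y + c - y * c ∉ P := by
  -- Left ideals for which `c` is a right unit modulo the ideal. They are proper exactly when they
  -- omit `c`, a condition that survives unions of chains.
  let S : Set (Submodule ℂ A) :=
    {L | (∀ a : A, ∀ x ∈ L, a * x ∈ L) ∧ I ≤ L ∧ (∀ y, y - y * c ∈ L) ∧ c ∉ L}
  let L₀ : Submodule ℂ A := I ⊔ LinearMap.range (LinearMap.id - LinearMap.mulRight ℂ c)
  have hL₀ : L₀ ∈ S := by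
    refine ⟨fun a x hx => ?_, le_sup_left, fun y => ?_, fun h => ?_⟩
    · obtain ⟨i, hi, _, ⟨y, rfl⟩, rfl⟩ := Submodule.mem_sup.mp hx
      refine Submodule.mem_sup.mpr ⟨a * i, hIl a i hi, _, ⟨a * y, rfl⟩, ?_⟩
      simp [mul_add, mul_sub, mul_assoc]
    · exact Submodule.mem_sup_right ⟨y, rfl⟩
    · obtain ⟨i, hi, _, ⟨y, rfl⟩, h⟩ := Submodule.mem_sup.mp h
      refine hc (-y) ?_
      have : -y + c - -y * c = i := by
        have h' : i + (y - y * c) = c := h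
        rw [eq_sub_of_add_eq h', neg_mul]; abel
      rwa [this]
  obtain ⟨L, -, hLS, hLmax⟩ := zorn_le_nonempty₀ S (fun C hCS hC M hM => by
    have hmem : ∀ x, x ∈ sSup C ↔ ∃ N ∈ C, x ∈ N := fun x =>
      Submodule.mem_sSup_of_directed ⟨M, hM⟩ hC.directedOn
    refine ⟨sSup C, ⟨fun a x hx => ?_, (hCS hM).2.1.trans (le_sSup hM), fun y => ?_, fun h => ?_⟩,
      fun N hN => le_sSup hN⟩
    · obtain ⟨N, hN, hxN⟩ := (hmem x).mp hx
      exact (hmem _).mpr ⟨N, hN, (hCS hN).1 a x hxN⟩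
    · exact (hmem _).mpr ⟨M, hM, (hCS hM).2.2.1 y⟩
    · obtain ⟨N, hN, hxN⟩ := (hmem c).mp h
      exact (hCS hN).2.2.2 hxN) L₀ hL₀
  have hmax : ∀ M ∈ S, L ≤ M → M = L := fun M hM h => le_antisymm (hLmax hM h) h
  obtain ⟨hL, hIL, hmod, hcL⟩ := hLS
  have hclosed : IsClosed (L : Set A) := by
    have hcl : L.topologicalClosure = L := by
      refine hmax _ ⟨fun a x hx => ?_, hIL.trans L.le_topologicalClosure,
        fun y => L.le_topologicalClosure (hmod y), fun h => ?_⟩ L.le_topologicalClosure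
      · exact map_mem_closure (continuous_const_mul a) hx fun z hz => hL a z hz
      -- If `l ∈ L` is within distance `1` of `c`, a left quasi-inverse of `c - l` forces `c ∈ L`.
      -- So the closure still omits `c`.
      · obtain ⟨l, hl, hdist⟩ := Metric.mem_closure_iff.mp h 1 one_pos
        rw [dist_eq_norm] at hdist
        obtain ⟨v, hv⟩ := exists_left_quasi_inverse_of_norm_lt_one hdist
        have e : c = l - (v - v * c) - v * l := by
          have : v + (c - l) - v * (c - l) = c - (l - (v - v * c) - v * l) := by
            rw [mul_sub]; abel
          rw [this] at hv
          exact sub_eq_zero.mp hv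
        refine hcL ?_
        rw [e]
        exact L.sub_mem (L.sub_mem hl (hmod v)) (hL v l hl)
    rw [← hcl]
    exact L.isClosed_topologicalClosure
  have hker : ∀ a, quotientRep L hL a = 0 ↔ ∀ x, a * x ∈ L := fun a => by
    constructor
    · intro h x
      rw [← Submodule.ker_mkQ L, LinearMap.mem_ker, ← quotientRep_mk L hL, h, LinearMap.zero_apply]
    · intro h
      ext x
      have : L.mkQ (a * x) = 0 := by
        rw [← LinearMap.mem_ker, Submodule.ker_mkQ]; exact h x
      exact this
  let P : ClosedIdeal A :=
    { carrier := {a | ∀ x, a * x ∈ L}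
      add_mem' := fun ha hb x => by rw [add_mul]; exact L.add_mem (ha x) (hb x)
      zero_mem' := fun x => by rw [zero_mul]; exact L.zero_mem
      smul_mem' := fun r a ha x => by rw [smul_mul_assoc]; exact L.smul_mem r (ha x)
      mul_mem_left' := fun a x hx z => by rw [mul_assoc]; exact hL a _ (hx z)
      mul_mem_right' := fun a hx z => by rw [mul_assoc]; exact hx _
      isClosed' := by
        rw [Set.ofPred_forall]
        exact isClosed_iInter fun x => hclosed.preimage (continuous_mul_const x) }
  -- For `d = y + c - y c` in `P`, both `d c` and `d - d c` lie in `L`, hence so do `d` and `c = d -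
  -- (y - y c)`.
  have hcP : ∀ y, y + c - y * c ∉ P := fun y hy => by
    have h1 : (y + c - y * c) * c ∈ L := hy c
    have h2 := hmod (y + c - y * c)
    have h3 := L.add_mem h2 h1
    rw [sub_add_cancel] at h3
    refine hcL ?_
    have := L.sub_mem h3 (hmod y)
    convert this using 1
    abel
  refine ⟨P, ⟨A ⧸ L, inferInstance, inferInstance, quotientRep L hL, ⟨fun h0 => ?_, fun K hK => ?_⟩,
    fun a => (hker a).symm⟩, fun x hx z => hIL (hIr z x hx), hcP⟩
  · refine hcP 0 ?_
    change ∀ x, (0 + c - 0 * c) * x ∈ L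
    refine (hker _).mp ?_
    rw [h0]; rfl
  · have hLM : L ≤ K.comap L.mkQ := fun x hx => by
      have : L.mkQ x = 0 := by rwa [← LinearMap.mem_ker, Submodule.ker_mkQ]
      rw [Submodule.mem_comap, this]; exact K.zero_mem
    have hM : ∀ a : A, ∀ x ∈ K.comap L.mkQ, a * x ∈ K.comap L.mkQ := fun a x hx => hK a _ hx
    by_cases hcM : c ∈ K.comap L.mkQ
    · right
      refine eq_top_iff.mpr fun q _ => ?_
      obtain ⟨a, rfl⟩ := L.mkQ_surjective q
      have := (K.comap L.mkQ).add_mem (hLM (hmod a)) (hM a c hcM)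
      rwa [sub_add_cancel] at this
    · left
      have := hmax _ ⟨hM, hIL.trans hLM, fun y => hLM (hmod y), hcM⟩ hLM
      refine eq_bot_iff.mpr fun q hq => ?_
      obtain ⟨a, rfl⟩ := L.mkQ_surjective q
      have ha : a ∈ L := by rw [← this]; exact hq
      rw [Submodule.mem_bot, ← LinearMap.mem_ker, Submodule.ker_mkQ]
      exact ha

/-- The primitive ideals modulo which `d` has no left quasi-inverse form a compact set. -/
theorem isCompact_setOf_prim_forall_notMem [CompleteSpace A] (d : A) :
    IsCompact {P : Prim A | ∀ y, y + d - y * d ∉ (P : ClosedIdeal A)} := by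
  rw [Topology.IsInducing.subtypeVal.isCompact_iff]
  have himg : (Subtype.val '' {P : Prim A | ∀ y, y + d - y * d ∉ (P : ClosedIdeal A)}) =
      {P : ClosedIdeal A | P ∈ Prim A ∧ ∀ y, y + d - y * d ∉ P} := by
    ext P
    constructor
    · rintro ⟨Q, hQ, rfl⟩
      exact ⟨Q.2, hQ⟩
    · rintro ⟨hP, h⟩
      exact ⟨⟨P, hP⟩, h, rfl⟩
  rw [himg]
  refine isCompact_generateFrom rfl fun C hC hcover => ?_
  let 𝒥 : Set (ClosedIdeal A) := {J | {I : ClosedIdeal A | ¬ J ≤ I} ∈ C}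
  -- By Alexander's subbase theorem only subbasic covers matter. The algebraic sum `T` of the ideals
  -- is not closed up: membership of `y + d - y d` in `T` then involves only finitely many of them.
  let T : Submodule ℂ A := ⨆ J : 𝒥, (J : ClosedIdeal A).toSubmodule
  have hTl : ∀ a : A, ∀ x ∈ T, a * x ∈ T := fun a x hx => by
    have : T ≤ T.comap (LinearMap.mulLeft ℂ a) := iSup_le fun J x hx =>
      Submodule.mem_iSup_of_mem J (J.1.mul_mem_left a hx)
    exact this hx
  have hTr : ∀ a : A, ∀ x ∈ T, x * a ∈ T := fun a x hx => by
    have : T ≤ T.comap (LinearMap.mulRight ℂ a) := iSup_le fun J x hx =>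
      Submodule.mem_iSup_of_mem J (J.1.mul_mem_right a hx)
    exact this hx
  obtain ⟨y, hy⟩ : ∃ y, y + d - y * d ∈ T := by
    by_contra! hne
    obtain ⟨P, hP, hTP, hdP⟩ := exists_prim_of_forall_notMem T hTl hTr hne
    obtain ⟨U, hU, hPU⟩ := hcover ⟨hP, hdP⟩
    obtain ⟨J, rfl⟩ := hC hU
    exact hPU fun x hx => hTP x (Submodule.mem_iSup_of_mem (⟨J, hU⟩ : 𝒥) hx)
  obtain ⟨F, hF⟩ := Submodule.exists_finset_of_mem_iSup _ hy
  refine ⟨(fun J : 𝒥 => {I : ClosedIdeal A | ¬ (J : ClosedIdeal A) ≤ I}) '' F, ?_,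
    F.finite_toSet.image _, ?_⟩
  · rintro _ ⟨J, -, rfl⟩
    exact J.2
  · rintro P ⟨-, hP⟩
    by_contra hnot
    refine hP y ?_
    have : (⨆ J ∈ F, (J : ClosedIdeal A).toSubmodule) ≤ P.toSubmodule := iSup₂_le fun J hJ => by
      by_contra h
      exact hnot ⟨_, ⟨J, hJ, rfl⟩, h⟩
    exact this hF

end QuasiInverse

/-! ### The hull-kernel topology -/

section HullKernel

variable {A : Type u} [NonUnitalNormedRing A] [NormedSpace ℂ A]

namespace ClosedIdeal

/-- The intersection of a set of closed ideals. -/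
def kernel (S : Set (ClosedIdeal A)) : ClosedIdeal A where
  carrier := {a | ∀ I ∈ S, a ∈ I}
  add_mem' ha hb I hI := I.toSubmodule.add_mem (ha I hI) (hb I hI)
  zero_mem' I _ := I.toSubmodule.zero_mem
  smul_mem' c _ ha I hI := I.toSubmodule.smul_mem c (ha I hI)
  mul_mem_left' a _ hx I hI := I.mul_mem_left a (hx I hI)
  mul_mem_right' a hx I hI := I.mul_mem_right a (hx I hI)
  isClosed' := by
    rw [show {a : A | ∀ I ∈ S, a ∈ I} = ⋂ I ∈ S, (I : Set A) by ext; simp]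
    exact isClosed_biInter fun I _ => I.isClosed

theorem le_kernel {S : Set (ClosedIdeal A)} {J : ClosedIdeal A} :
    J ≤ kernel S ↔ ∀ I ∈ S, J ≤ I :=
  ⟨fun h I hI _ ha => h ha I hI, fun h _ ha I hI => h I hI ha⟩

theorem kernel_le {S : Set (ClosedIdeal A)} {I : ClosedIdeal A} (hI : I ∈ S) : kernel S ≤ I :=
  fun _ ha => ha I hI

theorem IsPrime.le_or_le_of_kernel_le {P J K : ClosedIdeal A} (hP : P.IsPrime)
    (h : kernel {J, K} ≤ P) : J ≤ P ∨ K ≤ P := by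
  refine hP.2 J K fun a ha b hb => h ?_
  rintro I (rfl | rfl)
  · exact I.mul_mem_right b ha
  · exact I.mul_mem_left a hb

theorem isOpen_setOf_not_le (J : ClosedIdeal A) : IsOpen {I : ClosedIdeal A | ¬ J ≤ I} :=
  TopologicalSpace.isOpen_generateFrom_of_mem ⟨J, rfl⟩

/-- At a prime ideal the sets `{I | ¬ J ≤ I}` form a neighbourhood base. -/
theorem IsPrime.exists_not_le {P : ClosedIdeal A} (hP : P.IsPrime) {U : Set (ClosedIdeal A)}
    (hU : IsOpen U) (hPU : P ∈ U) : ∃ J : ClosedIdeal A, ¬ J ≤ P ∧ ∀ I, ¬ J ≤ I → I ∈ U := by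
  induction hU with
  | basic U hU =>
    obtain ⟨J, rfl⟩ := hU
    exact ⟨J, hPU, fun I hI => hI⟩
  | univ =>
    obtain ⟨a, ha⟩ := hP.1
    -- The empty intersection is the whole algebra, which a proper ideal does not contain.
    exact ⟨kernel ∅, fun h => ha (h fun I hI => hI.elim), fun I _ => trivial⟩
  | inter U V _ _ hU hV =>
    obtain ⟨J, hJ, hJU⟩ := hU hPU.1
    obtain ⟨K, hK, hKV⟩ := hV hPU.2
    refine ⟨kernel {J, K}, fun h => (hP.le_or_le_of_kernel_le h).elim hJ hK, fun I hI => ⟨?_, ?_⟩⟩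
    · exact hJU I fun h => hI ((kernel_le (by simp)).trans h)
    · exact hKV I fun h => hI ((kernel_le (by simp)).trans h)
  | sUnion C _ hC =>
    obtain ⟨U, hUC, hPU'⟩ := hPU
    obtain ⟨J, hJ, hJU⟩ := hC U hUC hPU'
    exact ⟨J, hJ, fun I hI => ⟨U, hUC, hJU I hI⟩⟩

/-- A closed set of prime ideals is the hull of its kernel. -/
theorem mem_iff_kernel_le_of_isClosed {X : Set (ClosedIdeal A)} (hX : ∀ P ∈ X, P.IsPrime)
    {S : Set X} (hS : IsClosed S) (P : X) : P ∈ S ↔ kernel (Subtype.val '' S) ≤ P := by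
  refine ⟨fun h => kernel_le ⟨P, h, rfl⟩, fun h => ?_⟩
  by_contra hPS
  obtain ⟨U, hU, hUS⟩ := isOpen_induced_iff.mp hS.isOpen_compl
  obtain ⟨J, hJ, hJU⟩ := (hX P P.2).exists_not_le hU (show P.1 ∈ U by
    have : P ∈ Subtype.val ⁻¹' U := by rw [hUS]; exact hPS
    exact this)
  refine hJ (le_trans (le_kernel.mpr ?_) h)
  rintro _ ⟨Q, hQ, rfl⟩
  by_contra hJQ
  have : Q ∈ Subtype.val ⁻¹' U := hJU Q hJQ
  rw [hUS] at this
  exact this hQ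

theorem isOpen_setOf_coe_not_le {X : Set (ClosedIdeal A)} (J : ClosedIdeal A) :
    IsOpen {P : X | ¬ J ≤ (P : ClosedIdeal A)} :=
  (isOpen_setOf_not_le J).preimage continuous_subtype_val

theorem exists_eq_setOf_not_le_of_isOpen {X : Set (ClosedIdeal A)} (hX : ∀ P ∈ X, P.IsPrime)
    {U : Set X} (hU : IsOpen U) : U = {P : X | ¬ kernel (Subtype.val '' Uᶜ) ≤ (P : ClosedIdeal A)} := by
  ext P
  rw [Set.mem_ofPred_eq, ← mem_iff_kernel_le_of_isClosed hX hU.isClosed_compl, Set.mem_compl_iff,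
    not_not]

end ClosedIdeal

end HullKernel

/-! ### Kernels of irreducible `*`-representations are prime and semisimple. -/

section PrimStarProperties

variable {A : Type u} [NonUnitalNormedRing A] [NormedSpace ℂ A] [StarRing A]

/-- The vectors killed by `J` form a closed invariant subspace containing the range of `K`. If it is
`0`, `K` acts as zero; if it is everything, `J` does. -/
theorem isPrime_of_mem_primStar {P : ClosedIdeal A} (hP : P ∈ PrimStar A) : P.IsPrime := by
  obtain ⟨ρ, ⟨hρ0, hρ⟩, hker⟩ := hP
  refine ⟨?_, fun J K hJK => ?_⟩
  · by_contra! h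
    exact hρ0 (NonUnitalStarAlgHom.ext fun a => (hker a).mp (h a))
  · by_contra! h
    obtain ⟨hJ, hK⟩ := h
    let N : Submodule ℂ ρ.H :=
      { carrier := {w | ∀ a ∈ J, ρ.π a w = 0}
        add_mem' := fun hx hy a ha => by rw [map_add, hx a ha, hy a ha, add_zero]
        zero_mem' := fun a _ => map_zero _
        smul_mem' := fun c x hx a ha => by rw [map_smul, hx a ha, smul_zero] }
    have hNc : IsClosed (N : Set ρ.H) := by
      rw [show (N : Set ρ.H) = ⋂ a ∈ J, {w | ρ.π a w = 0} by ext; simp [N]]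
      exact isClosed_biInter fun a _ => isClosed_eq (by fun_prop) continuous_const
    rcases hρ N hNc (fun a x hx b hb => by
      rw [← ContinuousLinearMap.comp_apply, ← ContinuousLinearMap.mul_def, ← map_mul]
      exact hx _ (J.mul_mem_right a hb)) with h | h
    · refine hK fun b hb => (hker b).mpr (ContinuousLinearMap.ext fun v => ?_)
      have : ρ.π b v ∈ N := fun a ha => by
        rw [← ContinuousLinearMap.comp_apply, ← ContinuousLinearMap.mul_def, ← map_mul,
          (hker _).mp (hJK a ha b hb)]
        rfl
      rw [h] at this
      exact this
    · refine hJ fun a ha => (hker a).mpr (ContinuousLinearMap.ext fun v => ?_)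
      have : v ∈ N := by rw [h]; trivial
      exact this a ha

variable [IsScalarTower ℂ A A] [SMulCommClass ℂ A A] [CompleteSpace A]

/-- If `a ∉ P`, then `T = ρ (a⋆ a)` has a real spectral value `z ≠ 0`, and `z⁻¹ a⋆ a` has no left
quasi-inverse modulo `P`. Some primitive ideal above `P` inherits this, so it cannot contain `a`. -/
theorem isSemisimple_of_mem_primStar {P : ClosedIdeal A} (hP : P ∈ PrimStar A) :
    P.IsSemisimple := by
  obtain ⟨ρ, -, hker⟩ := hP
  intro a ha
  by_contra haP
  set T := ρ.π (star a * a) with hT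
  have hTsa : IsSelfAdjoint T := (IsSelfAdjoint.star_mul_self a).map ρ.π
  have hT0 : T ≠ 0 := fun h0 => by
    rw [hT, map_mul, map_star, CStarRing.star_mul_self_eq_zero_iff] at h0
    exact haP ((hker a).mpr h0)
  have : Nontrivial (ρ.H →L[ℂ] ρ.H) := ⟨T, 0, hT0⟩
  obtain ⟨z, hz, hzr⟩ := spectrum.exists_nnnorm_eq_spectralRadius T
  rw [hTsa.spectralRadius_eq_nnnorm, ENNReal.coe_inj] at hzr
  have hz0 : z ≠ 0 := by
    rintro rfl
    rw [nnnorm_zero, eq_comm, nnnorm_eq_zero] at hzr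
    exact hT0 hzr
  have hzre : star z = z := by
    rw [hTsa.mem_spectrum_eq_re hz]; simp
  have hTz : IsSelfAdjoint (z⁻¹ • T) := IsSelfAdjoint.smul (by rw [IsSelfAdjoint, star_inv₀, hzre]) hTsa
  have hnu : ¬ IsUnit (1 - z⁻¹ • T) := fun h => hz (by
    have := h.smul (Units.mk0 z hz0)
    rwa [Units.smul_mk0, smul_sub, smul_smul, mul_inv_cancel₀ hz0, one_smul,
      ← Algebra.algebraMap_eq_smul_one] at this)
  obtain ⟨R, hR, hPR, hnR⟩ := exists_prim_of_forall_notMem P.toSubmodule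
    (fun a x hx => P.mul_mem_left a hx) (fun a x hx => P.mul_mem_right a hx)
    (c := z⁻¹ • (star a * a)) (fun y hy => by
      have h1 := (hker _).mp hy
      rw [map_sub, map_add, map_mul, map_smul, ← hT] at h1
      have h2 : (1 - ρ.π y) * (1 - z⁻¹ • T) = 1 := by
        have e : ∀ S : ρ.H →L[ℂ] ρ.H, (1 - ρ.π y) * (1 - S) = 1 - (ρ.π y + S - ρ.π y * S) :=
          fun S => by noncomm_ring
        rw [e, h1, sub_zero]
      have h3 := congrArg star h2
      rw [star_mul, star_one, star_sub 1 (z⁻¹ • T), star_one, hTz.star_eq] at h3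
      exact hnu (isUnit_iff_exists_and_exists.mpr ⟨⟨_, h3⟩, ⟨_, h2⟩⟩))
  refine hnR 0 ?_
  rw [zero_add, zero_mul, sub_zero]
  exact R.toSubmodule.smul_mem _ (R.mul_mem_left _ (ha R hR hPR))

end PrimStarProperties

/-! ### Primitive ideals of a `C*`-algebra -/

section Prim

variable {A : Type u} [NonUnitalNormedRing A] [NormedSpace ℂ A]

theorem isPrime_of_mem_prim {P : ClosedIdeal A} (hP : P ∈ Prim A) : P.IsPrime := by
  obtain ⟨X, _, _, π, hπ, hker⟩ := hP
  refine ⟨?_, fun J K hJK => ?_⟩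
  · by_contra! h
    exact hπ.1 (NonUnitalAlgHom.ext fun a => (hker a).mp (h a))
  · by_contra! h
    obtain ⟨hJ, hK⟩ := h
    obtain ⟨b, hb, hbP⟩ := SetLike.not_le_iff_exists.mp hK
    obtain ⟨v, hv⟩ : ∃ v, π b v ≠ 0 := by
      by_contra! h
      exact hbP ((hker b).mpr (LinearMap.ext h))
    refine hJ fun a ha => (hker a).mpr (LinearMap.ext fun w => ?_)
    obtain ⟨x, rfl⟩ := hπ.exists_apply_eq hv w
    rw [← Module.End.mul_apply, ← Module.End.mul_apply, ← map_mul, ← map_mul, mul_assoc,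
      (hker _).mp (hJK a ha _ (K.mul_mem_left x hb))]
    simp only [LinearMap.zero_apply]

/-- The closed ideal generated by an element. -/
def ClosedIdeal.generated (g : A) : ClosedIdeal A := ClosedIdeal.kernel {I | g ∈ I}

theorem ClosedIdeal.generated_le {g : A} {I : ClosedIdeal A} :
    ClosedIdeal.generated g ≤ I ↔ g ∈ I :=
  ⟨fun h => h fun _ hJ => hJ, fun h => ClosedIdeal.kernel_le h⟩

theorem ClosedIdeal.isOpen_setOf_notMem {X : Set (ClosedIdeal A)} (g : A) :
    IsOpen {P : X | g ∉ (P : ClosedIdeal A)} := by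
  simp only [← ClosedIdeal.generated_le]
  exact ClosedIdeal.isOpen_setOf_coe_not_le _

end Prim

/-! ### Functional calculus modulo closed ideals of a C*-algebra. -/

section CStar

variable {C : Type u} [NonUnitalCStarAlgebra C]

theorem ClosedIdeal.cfcₙ_mem (J : ClosedIdeal C) {y : C} (hy : IsSelfAdjoint y) (hyJ : y ∈ J)
    (f : ℝ → ℝ) : cfcₙ f y ∈ J := by
  -- Outside the domain of the functional calculus, `cfcₙ` takes the default value `0`.
  by_cases hf : ContinuousOn f (quasispectrum ℝ y)
  swap
  · rw [cfcₙ_apply_of_not_continuousOn y hf]; exact J.toSubmodule.zero_mem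
  by_cases hf0 : f 0 = 0
  swap
  · rw [cfcₙ_apply_of_not_map_zero y hf0]; exact J.toSubmodule.zero_mem
  -- Intersecting `J` with its adjoint avoids having to know that `J` is self-adjoint.
  let S : NonUnitalStarSubalgebra ℝ C :=
    { carrier := {x | x ∈ J ∧ star x ∈ J}
      add_mem' := fun ha hb => ⟨J.toSubmodule.add_mem ha.1 hb.1, by
        rw [star_add]; exact J.toSubmodule.add_mem ha.2 hb.2⟩
      zero_mem' := ⟨J.toSubmodule.zero_mem, by rw [star_zero]; exact J.toSubmodule.zero_mem⟩
      mul_mem' := fun {a b} ha hb => ⟨J.mul_mem_left a hb.1, by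
        rw [star_mul]; exact J.mul_mem_left _ ha.2⟩
      smul_mem' := fun c x hx => by
        refine ⟨?_, ?_⟩
        · rw [← Complex.coe_smul]; exact J.toSubmodule.smul_mem _ hx.1
        · rw [star_smul, ← Complex.coe_smul]; exact J.toSubmodule.smul_mem _ hx.2
      star_mem' := fun {x} hx => ⟨hx.2, by rw [star_star]; exact hx.1⟩ }
  have hS : IsClosed (S : Set C) := J.isClosed.inter (J.isClosed.preimage continuous_star)
  have hyS : y ∈ S := ⟨hyJ, by rwa [hy.star_eq]⟩
  exact (NonUnitalStarAlgebra.elemental.le_of_mem hS hyS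
    (cfcₙ_mem_elemental f y)).1

/-- The function is `t (1 - f t)²`, expanded to avoid a unit. -/
theorem star_sub_mul_cfcₙ_mul_self (b : C) {f : ℝ → ℝ} (hf : Continuous f) (hf0 : f 0 = 0) :
    star (b - b * cfcₙ f (star b * b)) * (b - b * cfcₙ f (star b * b)) =
      cfcₙ (fun t => (t - t * f t) - (f t * t - f t * (t * f t))) (star b * b) := by
  have hc : IsSelfAdjoint (star b * b) := IsSelfAdjoint.star_mul_self b
  have hxs : IsSelfAdjoint (cfcₙ f (star b * b)) := cfcₙ_predicate f (star b * b)
  have h1 : Continuous fun t : ℝ => t * f t := continuous_id.mul hf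
  have h2 : Continuous fun t : ℝ => f t * t := hf.mul continuous_id
  have h3 : Continuous fun t : ℝ => f t * (t * f t) := hf.mul h1
  rw [cfcₙ_sub (fun t : ℝ => t - t * f t) (fun t => f t * t - f t * (t * f t)) _
      (continuous_id.sub h1).continuousOn (by simp) (h2.sub h3).continuousOn (by simp),
    cfcₙ_sub (fun t : ℝ => t) (fun t => t * f t) _
      continuous_id.continuousOn rfl h1.continuousOn (by simp),
    cfcₙ_sub (fun t : ℝ => f t * t) (fun t => f t * (t * f t)) _
      h2.continuousOn (by simp) h3.continuousOn (by simp),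
    cfcₙ_mul f (fun t => t * f t) _ hf.continuousOn hf0 h1.continuousOn (by simp),
    cfcₙ_mul f (fun t => t) _ hf.continuousOn hf0 continuous_id.continuousOn rfl,
    cfcₙ_mul (fun t => t) f _ continuous_id.continuousOn rfl hf.continuousOn hf0,
    cfcₙ_id' ℝ (star b * b), star_sub, star_mul, hxs.star_eq]
  noncomm_ring

/-- `b` is the limit of `b f(b⋆ b)` with `f t = |t| / (|t| + ε)`: the squared error is at most the
supremum of `|t| ε² / (|t| + ε)²`, which is at most `ε`. The absolute values spare the positivity of
`b⋆ b`. -/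
theorem ClosedIdeal.mem_of_star_mul_self_mem (J : ClosedIdeal C) {b : C} (h : star b * b ∈ J) :
    b ∈ J := by
  have hc : IsSelfAdjoint (star b * b) := IsSelfAdjoint.star_mul_self b
  refine J.isClosed.closure_subset_iff.mpr subset_rfl ?_
  refine Metric.mem_closure_iff.mpr fun δ hδ => ?_
  set ε : ℝ := (δ / 2) ^ 2 with hε
  have hε0 : 0 < ε := by positivity
  obtain ⟨f, hfdef⟩ : ∃ f : ℝ → ℝ, ∀ t, f t = |t| / (|t| + ε) := ⟨_, fun _ => rfl⟩
  have hf : Continuous f := by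
    rw [funext hfdef]
    exact continuous_abs.div₀ (by fun_prop) fun t => by positivity
  have hf0 : f 0 = 0 := by simp [hfdef]
  refine ⟨b * cfcₙ f (star b * b), J.mul_mem_left b (J.cfcₙ_mem hc h f), ?_⟩
  have hnorm : ‖b - b * cfcₙ f (star b * b)‖ ^ 2 ≤ ε := by
    rw [sq, ← CStarRing.norm_star_mul_self, star_sub_mul_cfcₙ_mul_self b hf hf0]
    refine norm_cfcₙ_le fun t _ => ?_
    have h1 : 0 < |t| + ε := by positivity
    have h2 : (t - t * f t) - (f t * t - f t * (t * f t)) = t * (ε / (|t| + ε)) ^ 2 := by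
      rw [hfdef]; field_simp; ring
    rw [h2, norm_mul, Real.norm_eq_abs, Real.norm_of_nonneg (by positivity), div_pow,
      ← mul_div_assoc, div_le_iff₀ (by positivity)]
    nlinarith [abs_nonneg t, mul_nonneg (abs_nonneg t) hε0.le, sq_nonneg |t|,
      mul_nonneg (mul_nonneg (abs_nonneg t) hε0.le) (abs_nonneg t), pow_pos hε0 3]
  rw [dist_eq_norm]
  have : ‖b - b * cfcₙ f (star b * b)‖ ≤ δ / 2 := by
    rw [hε] at hnorm
    exact (abs_le_of_sq_le_sq' hnorm (by positivity)).2
  linarith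

/-- For `b` outside a closed ideal there are `d = b⋆ b m` and `g` outside that ideal such that `d` has
no left quasi-inverse modulo any closed ideal avoiding `g`. -/
theorem ClosedIdeal.exists_forall_notMem (R₀ : ClosedIdeal C) {b : C} (hb : b ∉ R₀) :
    ∃ g m : C, g ∉ R₀ ∧ ∀ R : ClosedIdeal C, g ∉ R →
      ∀ y, y + star b * b * m - y * (star b * b * m) ∉ R := by
  set c := star b * b with hcdef
  have hc : IsSelfAdjoint c := IsSelfAdjoint.star_mul_self b
  have hcR : c ∉ R₀ := fun h => hb (R₀.mem_of_star_mul_self_mem h)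
  obtain ⟨ε, hε, hball⟩ := Metric.isOpen_iff.mp R₀.isClosed.isOpen_compl c hcR
  -- `γ` vanishes for `|t| ≤ ε/2` and moves points by at most `ε/2`, so `γ(c)` stays outside `R₀`.
  -- `μ t = 1/t` for `|t| ≥ ε/2`, so `c μ(c)` is a left unit for `γ(c)`.
  obtain ⟨γ, hγdef⟩ : ∃ γ : ℝ → ℝ, ∀ t, γ t = t - max (-(ε / 2)) (min t (ε / 2)) :=
    ⟨_, fun _ => rfl⟩
  obtain ⟨μ, hμdef⟩ : ∃ μ : ℝ → ℝ, ∀ t, μ t = t / max (t ^ 2) ((ε / 2) ^ 2) := ⟨_, fun _ => rfl⟩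
  have hmax : ∀ t : ℝ, 0 < max (t ^ 2) ((ε / 2) ^ 2) := fun t =>
    lt_max_of_lt_right (by positivity)
  have hγ : Continuous γ := by
    rw [funext hγdef]; fun_prop
  have hμ : Continuous μ := by
    rw [funext hμdef]; exact continuous_id.div₀ (by fun_prop) fun t => (hmax t).ne'
  have hγ0 : γ 0 = 0 := by
    rw [hγdef, min_eq_left (by positivity), max_eq_right (by linarith), sub_zero]
  have hμ0 : μ 0 = 0 := by simp [hμdef]
  refine ⟨cfcₙ γ c, cfcₙ μ c, hball ?_, fun R hgR y hy => hgR ?_⟩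
  · rw [Metric.mem_ball, dist_comm, dist_eq_norm]
    have e : c - cfcₙ γ c = cfcₙ (fun t => t - γ t) c := by
      rw [cfcₙ_sub (fun t : ℝ => t) γ _ continuous_id.continuousOn rfl hγ.continuousOn hγ0,
        cfcₙ_id' ℝ c]
    rw [e]
    refine (norm_cfcₙ_le (c := ε / 2) fun t _ => ?_).trans_lt (by linarith)
    rw [hγdef, sub_sub_cancel, Real.norm_eq_abs]
    exact abs_le.mpr ⟨le_max_left _ _, max_le (by linarith) (min_le_right _ _)⟩
  · have e : c * cfcₙ μ c * cfcₙ γ c = cfcₙ γ c := by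
      have h1 : cfcₙ (fun t => t * μ t * γ t) c = c * cfcₙ μ c * cfcₙ γ c := by
        rw [cfcₙ_mul (fun t : ℝ => t * μ t) γ _ (continuous_id.mul hμ).continuousOn (by simp)
            hγ.continuousOn hγ0,
          cfcₙ_mul (fun t : ℝ => t) μ _ continuous_id.continuousOn rfl hμ.continuousOn hμ0,
          cfcₙ_id' ℝ c]
      rw [← h1]
      refine cfcₙ_congr fun t _ => ?_
      by_cases ht : |t| ≤ ε / 2
      · have : γ t = 0 := by
          rw [hγdef, min_eq_left (abs_le.mp ht).2, max_eq_right (abs_le.mp ht).1, sub_self]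
        simp [this]
      · have h2 : (ε / 2) ^ 2 ≤ t ^ 2 := by
          rw [← sq_abs t]; exact pow_le_pow_left₀ (by positivity) (not_le.mp ht).le 2
        have ht0 : t ≠ 0 := by rintro rfl; simp at ht; linarith
        have h3 : t * μ t = 1 := by
          rw [hμdef, max_eq_left h2]; field_simp
        simp only [h3, one_mul]
    -- As `d g = g`, multiplying `y + d - y d` on the right by `g` leaves `g` alone.
    have h2 := R.mul_mem_right (cfcₙ γ c) hy
    rw [sub_mul, add_mul, mul_assoc y, e, add_sub_cancel_left] at h2
    exact h2

/-- The space of primitive ideals of a `C*`-algebra is locally compact. -/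
theorem locallyCompactSpace_prim : LocallyCompactSpace (Prim C) := by
  refine ⟨fun P U hU => ?_⟩
  obtain ⟨V, hVU, hV, hPV⟩ := mem_nhds_iff.mp hU
  obtain ⟨W, hW, rfl⟩ := isOpen_induced_iff.mp hV
  obtain ⟨J, hJP, hJW⟩ := (isPrime_of_mem_prim P.2).exists_not_le hW hPV
  obtain ⟨b, hbJ, hbP⟩ := SetLike.not_le_iff_exists.mp hJP
  obtain ⟨g, m, hg, hgm⟩ := P.1.exists_forall_notMem hbP
  -- This compact set contains the open neighbourhood `g ∉ R`. If `b ∈ R`, then `d ∈ R` and `0` is a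
  -- left quasi-inverse of `d` modulo `R`, so the set avoids such `R`.
  refine ⟨_, ?_, ?_, isCompact_setOf_prim_forall_notMem (star b * b * m)⟩
  · exact Filter.mem_of_superset ((ClosedIdeal.isOpen_setOf_notMem g).mem_nhds hg)
      fun R hR => hgm R.1 hR
  · intro R hR
    refine hVU (hJW R.1 fun hJR => ?_)
    have h1 : star b * b * m ∈ R.1 := R.1.mul_mem_right m (R.1.mul_mem_left _ (hJR hbJ))
    exact hR 0 (by simpa using h1)

/-- The distance of `b` to a primitive ideal is locally bounded away from zero. -/
theorem exists_pos_eventually_le_norm_sub {P : Prim C} {b : C} (hb : b ∉ (P : ClosedIdeal C)) :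
    ∃ δ : ℝ, 0 < δ ∧ ∀ᶠ R : Prim C in 𝓝 P, ∀ r ∈ (R : ClosedIdeal C), δ ≤ ‖b - r‖ := by
  obtain ⟨g, m, hg, hgm⟩ := P.1.exists_forall_notMem hb
  -- If `‖b - r‖` is smaller than this, `b⋆ (b - r) m` has norm below `1` and hence a left
  -- quasi-inverse, which modulo `R` is one for `b⋆ b m`.
  refine ⟨(‖b‖ * ‖m‖ + 1)⁻¹, by positivity, ?_⟩
  filter_upwards [(ClosedIdeal.isOpen_setOf_notMem g).mem_nhds hg] with R hR r hr
  by_contra! hlt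
  have hnorm : ‖star b * (b - r) * m‖ < 1 := by
    have h1 : ‖star b * (b - r) * m‖ ≤ ‖b‖ * ‖b - r‖ * ‖m‖ := by
      refine (norm_mul_le _ _).trans ?_
      gcongr
      exact (norm_mul_le _ _).trans_eq (by rw [norm_star])
    have h2 : ‖b - r‖ * (‖b‖ * ‖m‖ + 1) < 1 := by
      rwa [← lt_div_iff₀ (by positivity), one_div]
    nlinarith [norm_nonneg (b - r)]
  obtain ⟨y, hy⟩ := exists_left_quasi_inverse_of_norm_lt_one hnorm
  refine hgm R.1 hR y ?_
  have h3 : star b * r * m ∈ R.1 := R.1.mul_mem_right m (R.1.mul_mem_left _ hr)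
  have e : y + star b * b * m - y * (star b * b * m) = star b * r * m - y * (star b * r * m) := by
    rw [← sub_eq_zero, ← hy]; noncomm_ring
  rw [e]
  exact R.1.toSubmodule.sub_mem h3 (R.1.mul_mem_left y h3)

end CStar

/-! ### The two notions of spectral synthesis -/

section Topology

variable {A : Type u} [NonUnitalNormedRing A] [NormedSpace ℂ A]

/-- At a prime ideal, open sets of closed ideals are lower sets. -/
theorem ClosedIdeal.IsPrime.mem_of_le {P Q : ClosedIdeal A} (hP : P.IsPrime)
    {U : Set (ClosedIdeal A)} (hU : IsOpen U) (hPU : P ∈ U) (h : Q ≤ P) : Q ∈ U := by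
  obtain ⟨J, hJP, hJU⟩ := hP.exists_not_le hU hPU
  exact hJU Q fun hJQ => hJP (hJQ.trans h)

theorem ClosedIdeal.IsSemisimple.exists_prim {Q J : ClosedIdeal A} (hQ : Q.IsSemisimple)
    (h : ¬ J ≤ Q) : ∃ R ∈ Prim A, Q ≤ R ∧ ¬ J ≤ R := by
  by_contra! hall
  exact h fun a ha => hQ a fun R hR hQR => hall R hR hQR ha

/-- Local compactness passes from a set `Y` with `Prim(A) ⊆ Y ⊆ Prim^s(A)` to `Prim^s(A)`. -/
theorem locallyCompactSpace_primS {Y : Set (ClosedIdeal A)} [LocallyCompactSpace Y]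
    (hPY : Prim A ⊆ Y) (hY : Y ⊆ PrimS A) : LocallyCompactSpace (PrimS A) := by
  refine ⟨fun Q N hN => ?_⟩
  obtain ⟨V, hVN, hV, hQV⟩ := mem_nhds_iff.mp hN
  obtain ⟨W, hW, rfl⟩ := isOpen_induced_iff.mp hV
  obtain ⟨J, hJQ, hJW⟩ := Q.2.1.exists_not_le hW hQV
  obtain ⟨R, hR, hQR, hJR⟩ := Q.2.2.exists_prim hJQ
  obtain ⟨K, hKR, hKJ, hK⟩ := local_compact_nhds
    ((ClosedIdeal.isOpen_setOf_coe_not_le (X := Y) J).mem_nhds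
      (show (⟨R, hPY hR⟩ : Y) ∈ {P : Y | ¬ J ≤ (P : ClosedIdeal A)} from hJR))
  obtain ⟨O, hOK, hO, hRO⟩ := mem_nhds_iff.mp hKR
  obtain ⟨O', hO', rfl⟩ := isOpen_induced_iff.mp hO
  obtain ⟨I, hIR, hIsub⟩ := (hY (hPY hR)).1.exists_not_le hO' hRO
  -- The intersection of all open neighbourhoods of a compact set is still compact. It contains
  -- every semisimple prime ideal below a member of `K`, since open sets are lower sets;
  -- semisimplicity puts each point near `Q` below such a member.
  have hcpt : IsCompact (nhdsKer (Set.inclusion hY '' K)) :=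
    IsCompact.nhdsKer_iff.mpr (hK.image (continuous_inclusion hY))
  refine ⟨_, ?_, fun x hx => ?_, hcpt⟩
  · refine Filter.mem_of_superset ((ClosedIdeal.isOpen_setOf_coe_not_le I).mem_nhds
      (show ¬ I ≤ (Q : ClosedIdeal A) from fun h => hIR (h.trans hQR))) fun x hx => ?_
    obtain ⟨R', hR', hxR', hIR'⟩ := x.2.2.exists_prim hx
    have hmem : (⟨R', hPY hR'⟩ : Y) ∈ K := hOK (hIsub R' hIR')
    refine mem_nhdsKer.mpr fun G hG hKG => ?_
    obtain ⟨G', hG', rfl⟩ := isOpen_induced_iff.mp hG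
    exact (hY (hPY hR')).1.mem_of_le hG' (hKG ⟨_, hmem, rfl⟩) hxR'
  · refine hVN (hJW x ?_)
    refine mem_nhdsKer.mp hx _ (ClosedIdeal.isOpen_setOf_coe_not_le J) ?_
    rintro _ ⟨P, hP, rfl⟩
    exact hKJ hP

/-- If all closed ideals are semisimple, they correspond to the open sets of primitive ideals. -/
theorem exists_orderIso_opens (h : ∀ I : ClosedIdeal A, I.IsSemisimple) :
    ∃ e : ClosedIdeal A ≃o TopologicalSpace.Opens (Prim A),
      ∀ (I : ClosedIdeal A) (P : Prim A), P ∈ e I ↔ ¬ I ≤ (P : ClosedIdeal A) := by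
  let f : ClosedIdeal A → TopologicalSpace.Opens (Prim A) := fun I =>
    ⟨{P | ¬ I ≤ (P : ClosedIdeal A)}, ClosedIdeal.isOpen_setOf_coe_not_le I⟩
  have hf : ∀ I J, f I ≤ f J ↔ I ≤ J := fun I J => by
    refine ⟨fun hIJ => ?_, fun hIJ P hP hJP => hP (hIJ.trans hJP)⟩
    by_contra hn
    obtain ⟨R, hR, hJR, hIR⟩ := (h J).exists_prim hn
    exact hIJ (show (⟨R, hR⟩ : Prim A) ∈ f I from hIR) hJR
  refine ⟨RelIso.ofSurjective (OrderEmbedding.ofMapLEIff f hf) fun U => ?_, fun I P => Iff.rfl⟩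
  exact ⟨_, TopologicalSpace.Opens.ext (ClosedIdeal.exists_eq_setOf_not_le_of_isOpen
    (fun _ hP => isPrime_of_mem_prim hP) U.2).symm⟩

end Topology

/-! ### Uniqueness of ideals with a given hull. -/

section UsualSynthesis

variable {A : Type u} [NonUnitalNormedRing A] [NormedSpace ℂ A] [StarRing A]

theorem HasSpectralSynthesis.hasUsualSpectralSynthesis (hsub : Prim A ⊆ PrimStar A)
    (h : HasSpectralSynthesis A) : HasUsualSpectralSynthesis A := by
  obtain ⟨e, he⟩ := h.latticeIso
  intro S hS
  have hhull : {P : PrimStar A | ClosedIdeal.kernel (Subtype.val '' S) ≤ (P : ClosedIdeal A)} = S :=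
    Set.ext fun P => (ClosedIdeal.mem_iff_kernel_le_of_isClosed
      (fun _ hP => isPrime_of_mem_primStar hP) hS P).symm
  refine ⟨_, hhull, fun I hI => e.injective (TopologicalSpace.Opens.ext (Set.ext fun P => ?_))⟩
  have := Set.ext_iff.mp (hI.trans hhull.symm) ⟨P, hsub P.2⟩
  exact (he I P).trans ((not_congr this).trans (he _ P).symm)

variable [IsScalarTower ℂ A A] [SMulCommClass ℂ A A] [CompleteSpace A]

/-- `J` and the kernel of its hull have the same hull, so uniqueness identifies them; an
intersection of semisimple ideals is semisimple. -/
theorem HasUsualSpectralSynthesis.isSemisimple (h : HasUsualSpectralSynthesis A)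
    (J : ClosedIdeal A) : J.IsSemisimple := by
  set S : Set (PrimStar A) := {P | J ≤ (P : ClosedIdeal A)} with hSdef
  have hS : IsClosed S := by
    have := (ClosedIdeal.isOpen_setOf_coe_not_le (X := PrimStar A) J).isClosed_compl
    convert this using 1
    ext P
    exact not_not.symm
  have hhull : {P : PrimStar A | ClosedIdeal.kernel (Subtype.val '' S) ≤ (P : ClosedIdeal A)} = S :=
    Set.ext fun P => (ClosedIdeal.mem_iff_kernel_le_of_isClosed
      (fun _ hP => isPrime_of_mem_primStar hP) hS P).symm
  have hJ : J = ClosedIdeal.kernel (Subtype.val '' S) := (h S hS).unique hSdef.symm hhull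
  intro a ha
  rw [hJ]
  rintro _ ⟨P, hP, rfl⟩
  exact isSemisimple_of_mem_primStar P.2 a fun R hR hPR => ha R hR (le_trans hP hPR)

end UsualSynthesis

/-! ### Local compactness and normality from `*`-regularity. -/

section StarRegular

variable {A : Type u} [NonUnitalNormedRing A] [NormedSpace ℂ A] [StarRing A]
  [IsScalarTower ℂ A A] [SMulCommClass ℂ A A] [CompleteSpace A]

theorem norm_toCStarEnvelope_le (a : A) : ‖toCStarEnvelope a‖ ≤ √‖star a * a‖ :=
  lp.norm_le_of_forall_le (Real.sqrt_nonneg _) fun ρ => ρ.norm_le a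

theorem toCStarEnvelope_sub (a b : A) :
    toCStarEnvelope (a - b) = toCStarEnvelope a - toCStarEnvelope b :=
  Subtype.ext (map_sub (universalRep A) a b)

theorem IsStarRegular.locallyCompactSpace_primStar (h : IsStarRegular A) :
    LocallyCompactSpace (PrimStar A) := by
  obtain ⟨e, -⟩ := h
  exact e.locallyCompactSpace_iff.mp locallyCompactSpace_prim

/-- The homeomorphism moves the net to `Prim(C*(A))`, where distances to the ideals are bounded
below near the limit. A representative of `a` modulo `P_α` of small norm in `A` would have small
C*-norm, because the involution is continuous. -/
theorem IsStarRegular.normalityOnPrim [ContinuousStar A] (h : IsStarRegular A)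
    (hsub : Prim A ⊆ PrimStar A) : NormalityOnPrim A := by
  obtain ⟨e, he⟩ := h
  intro ι _ _ _ net P hnet a ha
  have hmem : ∀ (Q : Prim A) (x : A), x ∈ (Q : ClosedIdeal A) ↔
      toCStarEnvelope x ∈ (e.symm (Set.inclusion hsub Q) : ClosedIdeal (CStarEnvelope A)) :=
    fun Q x => by
      rw [← he, e.apply_symm_apply]
  obtain ⟨δ, hδ, hev⟩ := exists_pos_eventually_le_norm_sub (mt (hmem P a).mpr ha)
  have hcont : Continuous fun x : A => √‖star x * x‖ := by fun_prop
  obtain ⟨η, hη, hηδ⟩ := Metric.continuousAt_iff.mp (hcont.continuousAt (x := 0)) δ hδ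
  have htend : Tendsto (fun α => e.symm (Set.inclusion hsub (net α))) atTop
      (𝓝 (e.symm (Set.inclusion hsub P))) :=
    ((e.symm.continuous.comp (continuous_inclusion hsub)).tendsto P).comp hnet
  refine hη.trans_le (le_liminf_of_le ?_ ?_)
  -- A real `liminf` has its expected meaning only for nets bounded from above along a subnet; here
  -- `‖a‖` is a bound.
  · exact (isBoundedUnder_of ⟨‖a‖, fun α =>
      Submodule.Quotient.norm_mk_le _ a⟩).isCoboundedUnder_ge
  · filter_upwards [htend.eventually hev] with α hα
    by_contra! hlt
    obtain ⟨m, hm, hmη⟩ := Submodule.Quotient.norm_mk_lt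
      (Submodule.Quotient.mk a : A ⧸ (net α : ClosedIdeal A).toSubmodule) (sub_pos.mpr hlt)
    have hmη' : ‖m‖ < η := by
      unfold ClosedIdeal.quotNorm at hmη
      linarith
    have hmem' : a - m ∈ (net α : ClosedIdeal A) := (Submodule.Quotient.eq _).mp hm.symm
    have h1 := hα _ ((hmem (net α) (a - m)).mp hmem')
    rw [← toCStarEnvelope_sub, sub_sub_cancel] at h1
    have h2 := hηδ (x := m) (by simpa using hmη')
    simp only [Real.dist_eq, star_zero, mul_zero, norm_zero, Real.sqrt_zero, sub_zero] at h2
    exact absurd ((h1.trans (norm_toCStarEnvelope_le m)).trans (le_abs_self _)) (not_le.mpr h2)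

end StarRegular

end

theorem theorem2p1 (A : Type*) [NonUnitalNormedRing A] [NormedSpace ℂ A] [CompleteSpace A]
    [IsScalarTower ℂ A A] [SMulCommClass ℂ A A] [StarRing A] [StarModule ℂ A]
    (hherm : IsHermitianAlgebra A) (hreg : IsStarRegular A) (hss : IsStarSemisimple A) :
    HasSpectralSynthesis A ↔ HasUsualSpectralSynthesis A := by
  have := continuousStar_of_isStarSemisimple hss
  have hsub := prim_subset_primStar hherm
  have := hreg.locallyCompactSpace_primStar
  exact ⟨fun h => h.hasUsualSpectralSynthesis hsub, fun h =>
    ⟨locallyCompactSpace_primS hsub fun _ hP =>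
      ⟨isPrime_of_mem_primStar hP, isSemisimple_of_mem_primStar hP⟩,
      hreg.normalityOnPrim hsub, exists_orderIso_opens h.isSemisimple⟩⟩
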